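/- **Setting.** Let $R=\mathbb C[z_1,z_2]$ and $A=\mathbb C[z_1^2,z_1^3,z_2^2,z_2^3]\subset R$. Let $\mathfrak S$ be the space of formal operators $P=\sum_{k\in\mathbb N_0^2}a_k(x_1,x_2)\,\partial_1^{k_1}\partial_2^{k_2}$, $a_k\in\mathbb C[[x_1,x_2]]$, whose order $o(P)=\sup_k\bigl(k_1+k_2-\upsilon(a_k)\bigr)$ is $<\infty$, where $\upsilon$ is the $(x_1,x_2)$-adic valuation. It is an algebra under the Leibniz product. Let $\mathfrak m=(x_1,x_2)$. The algebra $\mathfrak S$ acts from the right on $F=\mathfrak S/\mathfrak m\mathfrak S\cong\mathbb C[\partial_1,\partial_2]$, and $F$ is identified with $R$ by $\partial_i=z_i$; write $f\circ P$ for this action. If $o(P)=d$, the symbol $\sigma(P)$ is the sum of all terms $\alpha\,x^{s}\partial^{k}$ of $P$ with $|k|-|s|=d$; $P$ is regular if $f\mapsto f\circ\sigma(P)$ is injective on $F$. Let $\mathsf{Gr}_\mu(R)$ be the set of subspaces $W\subseteq R$ with $\dim_{\mathbb C}\{w\in W:\deg w\le \mu+k\}=\binom{k+2}{2}$ for all $k\ge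 0$. A Sato operator of $W\in\mathsf{Gr}_\mu(R)$ is a regular operator $S\in\mathfrak S$ with $o(S)=\mu$ and $W=F\circ S$. Finally let $E_i=\sum_{n\ge0}\frac{(-x_i)^n}{n!}\partial_i^n\in\mathfrak S$ for $i=1,2$; this is the delta-function operator setting $x_i=0$. **Theorem.** Let $\xi_1,\xi_2,\beta\in\mathbb C$ with $\xi_1\xi_2\neq0$ and $\beta\ne\xi_1\xi_2$, and let $$W_\beta=\Bigl\{f\in R:\ \tfrac{\partial f}{\partial z_1}(0,\rho)=\tfrac{\xi_1^2}{\xi_1+\beta\rho}f(0,\rho),\ \ \tfrac{\partial f}{\partial z_2}(\rho,0)=\tfrac{\xi_2^2}{\xi_2+\beta\rho}f(\rho,0)\ \text{ in }\mathbb C(\rho)\Bigr\}.$$ Then $$W_\beta=\mathbb C w+(\xi_2+\xi_2^2z_2+\beta z_1)z_1^2\mathbb C[z_1]+(\xi_1+\xi_1^2z_1+\beta z_2)z_2^2\mathbb C[z_2]+z_1^2z_2^2\mathbb C[z_1,z_2],$$ $$w=1+\xi_1z_1+\xi_2z_2+(\xi_1\xi_2-\beta)\Bigl(z_1z_2+\beta\bigl(\tfrac{z_1^2}{\xi_2^2}+\tfrac{z_2^2}{\xi_1^2}\bigr)\Bigr);$$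 $W_\beta$ is a (maximal) Cohen–Macaulay $A$-module, it is not projective over $A$ if $\beta\neq0$, and $W_\beta\in\mathsf{Gr}_2(R)$. The operator $S_\beta=S_0+\beta T$ with $$S_0=\partial_1\partial_2+\frac1{\xi_2-x_2}\partial_1+\frac1{\xi_1-x_1}\partial_2+\frac1{(\xi_1-x_1)(\xi_2-x_2)},$$ $$T=\frac1{(\xi_1-x_1)(\xi_2-x_2)}\Bigl(\frac1{\xi_2}\bigl(E_2\partial_1+(\xi_1-x_1)E_2\partial_1^2\bigr)+\frac1{\xi_1}\bigl(E_1\partial_2+(\xi_2-x_2)E_1\partial_2^2\bigr)\Bigr)$$ $$\qquad+\frac1{(\xi_1\xi_2-\beta)(\xi_1-x_1)(\xi_2-x_2)}E_1E_2\Bigl(1+\beta\bigl(\tfrac{\partial_1}{\xi_2}+\tfrac{\partial_2}{\xi_1}\bigr)\Bigr)$$ belongs to $\mathfrak S$ and is a Sato operator of $W_\beta$. -/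

import Mathlib

namespace SatoExample

noncomputable section

/-! ### Operators in two variables -/

/-- Exponents `(k₁, k₂)`; `k.degree` is `k₁ + k₂`. -/
abbrev Expo : Type := Fin 2 →₀ ℕ

/-- The power series ring `ℂ⟦x₁, x₂⟧`; the variables are `MvPowerSeries.X 0`, `MvPowerSeries.X 1`. -/
abbrev PS : Type := MvPowerSeries (Fin 2) ℂ

/-- The polynomial ring `R = ℂ[z₁, z₂]`. It is also used as `F = ℂ[∂₁, ∂₂]`, with `zᵢ = ∂ᵢ`. -/
abbrev Poly : Type := MvPolynomial (Fin 2) ℂ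

/-- The vector space `ℂ⟦x₁, x₂⟧⟦∂₁, ∂₂⟧`: the family `P` stands for the formal sum
`∑ₖ P k · ∂ᵏ`, with coefficients on the left. -/
abbrev FormalOp : Type := Expo → PS

/-- The set of all `|k| - |s|` such that `xˢ ∂ᵏ` occurs in `P`. Its supremum is the order
`sup {|k| - υ(P k)}` of `P`, because `υ(P k)` is the least `|s|` such that `xˢ` occurs in `P k`. -/
def orderSet (P : FormalOp) : Set ℤ :=
  {e | ∃ k s : Expo, MvPowerSeries.coeff s (P k) ≠ 0 ∧ e = (k.degree : ℤ) - (s.degree : ℤ)}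

/-- `P` has order (exactly) `d`. -/
def HasOrder (P : FormalOp) (d : ℤ) : Prop := IsLUB (orderSet P) d

/-- The space `𝔖` of all formal operators of order `< ∞`. -/
def opSpace : Submodule ℂ FormalOp where
  carrier := {P | BddAbove (orderSet P)}
  zero_mem' := ⟨0, by rintro e ⟨k, s, h, -⟩; simp at h⟩
  add_mem' := by
    rintro P Q ⟨d, hd⟩ ⟨e, he⟩
    refine ⟨max d e, ?_⟩
    rintro _ ⟨k, s, h, rfl⟩
    by_cases hP : MvPowerSeries.coeff s (P k) = 0
    · refine le_max_of_le_right (he ⟨k, s, ?_, rfl⟩)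
      intro hQ
      exact h (by simp [hP, hQ])
    · exact le_max_of_le_left (hd ⟨k, s, hP, rfl⟩)
  smul_mem' := by
    rintro c P ⟨d, hd⟩
    refine ⟨d, ?_⟩
    rintro _ ⟨k, s, h, rfl⟩
    refine hd ⟨k, s, ?_, rfl⟩
    intro hP
    exact h (by simp [hP])

/-- The type of elements of `𝔖`. -/
abbrev Op : Type := ↥opSpace

/-- `∂₁^{i₁} ∂₂^{i₂}` applied to a power series. -/
def iterD (i : Expo) (f : PS) : PS :=
  (MvPowerSeries.pderiv ℂ (0 : Fin 2))^[i 0] ((MvPowerSeries.pderiv ℂ (1 : Fin 2))^[i 1] f)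

theorem coeff_pderiv_iterate_ne (a : Fin 2) (n : ℕ) (f : PS) (v : Expo)
    (h : MvPowerSeries.coeff v ((MvPowerSeries.pderiv ℂ a)^[n] f) ≠ 0) :
    MvPowerSeries.coeff (v + Finsupp.single a n) f ≠ 0 := by
  induction n generalizing v with
  | zero => simpa using h
  | succ n ih =>
    rw [Function.iterate_succ_apply', MvPowerSeries.coeff_pderiv] at h
    have := ih _ (left_ne_zero_of_mul h)
    rwa [add_assoc, ← Finsupp.single_add, add_comm 1 n] at this

theorem coeff_iterD_ne (i : Expo) (f : PS) (v : Expo)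
    (h : MvPowerSeries.coeff v (iterD i f) ≠ 0) : MvPowerSeries.coeff (v + i) f ≠ 0 := by
  have h2 := coeff_pderiv_iterate_ne 1 _ _ _ (coeff_pderiv_iterate_ne 0 _ _ _ h)
  have hi : Finsupp.single 0 (i 0) + Finsupp.single 1 (i 1) = i := by
    ext a; fin_cases a <;> simp
  rwa [add_assoc, hi] at h2

/-- The Leibniz product `P · Q = ∑_{k, l} ∑_{i ≤ k} (k choose i) P_k (∂ⁱ Q_l) ∂^{k+l-i}`, written out
for the coefficient of `xˢ ∂ʲ`. Here `k = r + i`, and `(r, l)` runs over the pairs with `r + l = j`.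
For `P` in `𝔖` only finitely many `i` contribute to that coefficient. -/
def mulFun (P Q : FormalOp) : FormalOp := fun j s =>
  ∑ p ∈ Finset.HasAntidiagonal.antidiagonal j, ∑ᶠ i : Expo,
    (((p.1 + i) 0).choose (i 0) * ((p.1 + i) 1).choose (i 1) : ℂ) *
      MvPowerSeries.coeff s (P (p.1 + i) * iterD i (Q p.2))

theorem mulFun_mem {P Q : FormalOp} (hP : P ∈ opSpace) (hQ : Q ∈ opSpace) :
    mulFun P Q ∈ opSpace := by
  obtain ⟨d, hd⟩ := hP
  obtain ⟨e, he⟩ := hQ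
  refine ⟨d + e, ?_⟩
  rintro _ ⟨j, s, h, rfl⟩
  obtain ⟨p, hp, h1⟩ := Finset.exists_ne_zero_of_sum_ne_zero
    (show ∑ p ∈ Finset.HasAntidiagonal.antidiagonal j, ∑ᶠ i : Expo,
      (((p.1 + i) 0).choose (i 0) * ((p.1 + i) 1).choose (i 1) : ℂ) *
      MvPowerSeries.coeff s (P (p.1 + i) * iterD i (Q p.2)) ≠ 0 from h)
  obtain ⟨i, h2⟩ : ∃ i : Expo, (((p.1 + i) 0).choose (i 0) * ((p.1 + i) 1).choose (i 1) : ℂ) *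
      MvPowerSeries.coeff s (P (p.1 + i) * iterD i (Q p.2)) ≠ 0 := by
    by_contra! hh
    exact h1 ((finsum_congr hh).trans finsum_zero)
  have h3 := right_ne_zero_of_mul h2
  rw [MvPowerSeries.coeff_mul] at h3
  obtain ⟨q, hq, h4⟩ := Finset.exists_ne_zero_of_sum_ne_zero h3
  have a1 := hd ⟨_, _, left_ne_zero_of_mul h4, rfl⟩
  have a2 := he ⟨_, _, coeff_iterD_ne _ _ _ (right_ne_zero_of_mul h4), rfl⟩
  rw [Finset.HasAntidiagonal.mem_antidiagonal] at hp hq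
  rw [← hp, ← hq]
  simp only [map_add, Nat.cast_add] at a1 a2 ⊢
  linarith

instance : Mul Op := ⟨fun P Q => ⟨mulFun P.1 Q.1, mulFun_mem P.2 Q.2⟩⟩

/-- The operator of multiplication by a power series. -/
def fn (a : PS) : Op := ⟨fun k => if k = 0 then a else 0, 0, by
  rintro _ ⟨k, s, h, rfl⟩
  by_cases hk : k = 0
  · simp [hk]
  · simp [hk] at h⟩

instance : One Op := ⟨fn 1⟩

/-- A polynomial in `∂₁, ∂₂` with constant coefficients, as an element of `𝔖`. -/
def ofPoly (f : Poly) : Op := ⟨fun k => MvPowerSeries.C (MvPolynomial.coeff k f), f.totalDegree, by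
  rintro _ ⟨k, s, h, rfl⟩
  have hk : MvPolynomial.coeff k f ≠ 0 := by
    intro h0
    simp [h0] at h
  have h1 : k.degree ≤ f.totalDegree := by
    exact MvPolynomial.le_totalDegree (MvPolynomial.mem_support_iff.mpr hk)
  omega⟩

/-- The partial derivatives `∂₁ = pd 0` and `∂₂ = pd 1`. -/
def pd (i : Fin 2) : Op := ofPoly (MvPolynomial.X i)

/-- The delta-function operator `E_i = exp((-x_i) * ∂_i) = ∑ₙ (-x_i)ⁿ / n! · ∂_iⁿ`, so that
`E₁ = E 0` and `E₂ = E 1`. -/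
def E (i : Fin 2) : Op := ⟨fun k =>
    if k = Finsupp.single i (k i) then
      MvPowerSeries.C (((k i).factorial : ℂ)⁻¹) * (-MvPowerSeries.X i) ^ (k i)
    else 0, 0, by
  rintro _ ⟨k, s, h, rfl⟩
  have hk : k = Finsupp.single i (k i) := by
    by_contra hk
    simp [hk] at h
  beta_reduce at h
  rw [if_pos hk, MvPowerSeries.coeff_C_mul, neg_pow, ← map_one MvPowerSeries.C, ← map_neg,
    ← map_pow, MvPowerSeries.coeff_C_mul] at h
  have h1 := right_ne_zero_of_mul (right_ne_zero_of_mul h)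
  rw [MvPowerSeries.coeff_X_pow] at h1
  have hs : s = Finsupp.single i (k i) := by
    by_contra hs
    simp [hs] at h1
  rw [hs, ← hk, sub_self]⟩

/-! ### The right action on `F = ℂ[∂₁, ∂₂]`, regular operators, Sato operators -/

/-- The projection `𝔖 → 𝔖 / 𝔪𝔖 = ℂ[∂₁, ∂₂]`, `∑ₖ a_k ∂ᵏ ↦ ∑ₖ a_k(0) ∂ᵏ`. The sum is finite
because `P` has finite order. -/
def atZero (P : Op) : Poly :=
  ∑ᶠ k : Expo, MvPolynomial.monomial k (MvPowerSeries.constantCoeff (P.1 k))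

/-- The right action `f ∘ P` of `𝔖` on `F = 𝔖 / 𝔪𝔖 = ℂ[∂₁, ∂₂]`. -/
def rightAct (f : Poly) (P : Op) : Poly := atZero (ofPoly f * P)

/-- The homogeneous component of `P` that collects all terms `xˢ ∂ᵏ` with `|s| - |k| = m`. -/
def component (P : Op) (m : ℤ) : Op :=
  ⟨fun k s => if (s.degree : ℤ) - (k.degree : ℤ) = m then MvPowerSeries.coeff s (P.1 k) else 0, by
    obtain ⟨d, hd⟩ := P.2
    refine ⟨d, ?_⟩
    rintro _ ⟨k, s, h, rfl⟩
    refine hd ⟨k, s, ?_, rfl⟩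
    intro h0
    apply h
    change (if (s.degree : ℤ) - (k.degree : ℤ) = m then MvPowerSeries.coeff s (P.1 k) else 0) = 0
    rw [h0, ite_self]⟩

/-- `P` is regular: the right action of its symbol (the component of top order) on `F` is
injective. -/
def IsRegularOp (P : Op) : Prop :=
  ∃ d : ℤ, HasOrder P.1 d ∧ Function.Injective fun f : Poly => rightAct f (component P (-d))

/-- `W ∈ Gr_μ(R)`: the elements of degree at most `μ + k` in `W` form a space of dimension
`(k + 2 choose 2)`, for every `k ≥ 0`. -/
def IsInGr (μ : ℕ) (W : Submodule ℂ Poly) : Prop :=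
  ∀ k : ℕ, Module.finrank ℂ
    ↥(W ⊓ MvPolynomial.restrictTotalDegree (Fin 2) ℂ (μ + k)) = (k + 2).choose 2

/-- `S` is a Sato operator of `W ∈ Gr_μ(R)`. -/
structure IsSatoOperator (μ : ℕ) (W : Submodule ℂ Poly) (S : Op) : Prop where
  regular : IsRegularOp S
  order_eq : HasOrder S.1 μ
  range_eq : (W : Set Poly) = Set.range fun f : Poly => rightAct f S

/-! ### The algebra of quasi-invariants and the module `W_β` -/

/-- `A = ℂ[z₁², z₁³, z₂², z₂³]`. -/
def qAlg : Subalgebra ℂ Poly :=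
  Algebra.adjoin ℂ {MvPolynomial.X 0 ^ 2, MvPolynomial.X 0 ^ 3,
    MvPolynomial.X 1 ^ 2, MvPolynomial.X 1 ^ 3}

/-- `f ↦ f(ρ, 0)`, with values in `ℂ(ρ)`. -/
def line₁ : Poly →ₐ[ℂ] RatFunc ℂ := MvPolynomial.aeval ![RatFunc.X, 0]

/-- `f ↦ f(0, ρ)`, with values in `ℂ(ρ)`. -/
def line₂ : Poly →ₐ[ℂ] RatFunc ℂ := MvPolynomial.aeval ![0, RatFunc.X]

theorem line₁_pderiv_eq_zero {a : Poly} (ha : a ∈ qAlg) :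
    line₁ (MvPolynomial.pderiv 1 a) = 0 := by
  induction ha using Algebra.adjoin_induction with
  | mem x hx =>
    simp only [Set.mem_insert_iff, Set.mem_singleton_iff] at hx
    rcases hx with rfl | rfl | rfl | rfl <;>
      simp [line₁]
  | algebraMap r => simp [MvPolynomial.algebraMap_eq]
  | add x y _ _ hx hy => simp [hx, hy]
  | mul x y _ _ hx hy => simp [hx, hy]

theorem line₂_pderiv_eq_zero {a : Poly} (ha : a ∈ qAlg) :
    line₂ (MvPolynomial.pderiv 0 a) = 0 := by
  induction ha using Algebra.adjoin_induction with
  | mem x hx =>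
    simp only [Set.mem_insert_iff, Set.mem_singleton_iff] at hx
    rcases hx with rfl | rfl | rfl | rfl <;>
      simp [line₂]
  | algebraMap r => simp [MvPolynomial.algebraMap_eq]
  | add x y _ _ hx hy => simp [hx, hy]
  | mul x y _ _ hx hy => simp [hx, hy]

/-- The `A`-module `B(γ₁, γ₂)` of all `f ∈ R` such that `∂f/∂φ = γ₁ f` on the line `φ = 0` and
`∂f/∂φ = γ₂ f` on the line `φ = π/2`, where `(z₁, z₂) = (ρ cos φ, ρ sin φ)`. -/
def moduleB (γ₁ γ₂ : RatFunc ℂ) : Submodule qAlg Poly where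
  carrier := {f |
    RatFunc.X * line₁ (MvPolynomial.pderiv 1 f) = γ₁ * line₁ f ∧
    -RatFunc.X * line₂ (MvPolynomial.pderiv 0 f) = γ₂ * line₂ f}
  zero_mem' := by simp
  add_mem' := by
    rintro f g ⟨hf1, hf2⟩ ⟨hg1, hg2⟩
    constructor
    · simp only [map_add, mul_add, hf1, hg1]
    · simp only [map_add, mul_add, hf2, hg2]
  smul_mem' := by
    rintro ⟨a, ha⟩ f ⟨hf1, hf2⟩
    have e : (⟨a, ha⟩ : qAlg) • f = a * f := rfl
    constructor
    · simp only [e, Derivation.leibniz, smul_eq_mul, map_add, map_mul, line₁_pderiv_eq_zero ha]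
      linear_combination line₁ a * hf1
    · simp only [e, Derivation.leibniz, smul_eq_mul, map_add, map_mul, line₂_pderiv_eq_zero ha]
      linear_combination line₂ a * hf2

/-- The module `W_β = B(ξ₂² ρ / (ξ₂ + β ρ), -ξ₁² ρ / (ξ₁ + β ρ))`. -/
def moduleW (ξ₁ ξ₂ β : ℂ) : Submodule qAlg Poly :=
  moduleB
    (RatFunc.C (ξ₂ ^ 2) * RatFunc.X / (RatFunc.C ξ₂ + RatFunc.C β * RatFunc.X))
    (-(RatFunc.C (ξ₁ ^ 2) * RatFunc.X / (RatFunc.C ξ₁ + RatFunc.C β * RatFunc.X)))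

open MvPolynomial in
/-- The explicit space
`ℂ w + (ξ₂ + ξ₂² z₂ + β z₁) z₁² ℂ[z₁] + (ξ₁ + ξ₁² z₁ + β z₂) z₂² ℂ[z₂] + z₁² z₂² ℂ[z₁, z₂]`, where
`w = 1 + ξ₁ z₁ + ξ₂ z₂ + (ξ₁ ξ₂ - β) (z₁ z₂ + β (z₁² / ξ₂² + z₂² / ξ₁²))`. -/
def explicitW (ξ₁ ξ₂ β : ℂ) : Submodule ℂ Poly :=
  Submodule.span ℂ {1 + C ξ₁ * X 0 + C ξ₂ * X 1 + C (ξ₁ * ξ₂ - β) *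
      (X 0 * X 1 + C β * (C (1 / ξ₂ ^ 2) * X 0 ^ 2 + C (1 / ξ₁ ^ 2) * X 1 ^ 2))} ⊔
  Submodule.map (LinearMap.mulLeft ℂ ((C ξ₂ + C (ξ₂ ^ 2) * X 1 + C β * X 0) * X 0 ^ 2))
    (Subalgebra.toSubmodule (Algebra.adjoin ℂ {(X 0 : Poly)})) ⊔
  Submodule.map (LinearMap.mulLeft ℂ ((C ξ₁ + C (ξ₁ ^ 2) * X 0 + C β * X 1) * X 1 ^ 2))
    (Subalgebra.toSubmodule (Algebra.adjoin ℂ {(X 1 : Poly)})) ⊔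
  LinearMap.range (LinearMap.mulLeft ℂ (X 0 ^ 2 * X 1 ^ 2 : Poly))

/-- `M` is a (maximal) Cohen–Macaulay module over the Noetherian ring `B`: it is finitely generated
and, for every maximal ideal `𝔪`, the depth of `M_𝔪` is the Krull dimension of `B_𝔪`. -/
def IsMaximalCohenMacaulay (B M : Type*) [CommRing B] [AddCommGroup M] [Module B M] : Prop :=
  Module.Finite B M ∧ ∀ (𝔪 : Ideal B) [𝔪.IsMaximal],
    ∃ rs : List (Localization.AtPrime 𝔪),
      (∀ r ∈ rs, r ∈ IsLocalRing.maximalIdeal (Localization.AtPrime 𝔪)) ∧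
      RingTheory.Sequence.IsRegular (LocalizedModule 𝔪.primeCompl M) rs ∧
      (rs.length : WithBot ℕ∞) = ringKrullDim (Localization.AtPrime 𝔪)

/-! ### The operators `S₀`, `T` and `S_β` -/

/-- `ξ₁ - x₁` for `i = 0`, and `ξ₂ - x₂` for `i = 1`. -/
def shift (i : Fin 2) (ξ : ℂ) : PS := MvPowerSeries.C ξ - MvPowerSeries.X i

/-- `S₀ = ∂₁∂₂ + (ξ₂ - x₂)⁻¹ ∂₁ + (ξ₁ - x₁)⁻¹ ∂₂ + (ξ₁ - x₁)⁻¹ (ξ₂ - x₂)⁻¹`. -/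
def opS₀ (ξ₁ ξ₂ : ℂ) : Op :=
  pd 0 * pd 1 + fn (shift 1 ξ₂)⁻¹ * pd 0 + fn (shift 0 ξ₁)⁻¹ * pd 1
    + fn ((shift 0 ξ₁)⁻¹ * (shift 1 ξ₂)⁻¹)

/-- The operator `T`, which depends on `β` as well. -/
def opT (ξ₁ ξ₂ β : ℂ) : Op :=
  fn ((shift 0 ξ₁)⁻¹ * (shift 1 ξ₂)⁻¹) *
      ((1 / ξ₂) • (E 1 * pd 0 + fn (shift 0 ξ₁) * (E 1 * (pd 0 * pd 0)))
        + (1 / ξ₁) • (E 0 * pd 1 + fn (shift 1 ξ₂) * (E 0 * (pd 1 * pd 1))))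
    + (1 / (ξ₁ * ξ₂ - β)) • (fn ((shift 0 ξ₁)⁻¹ * (shift 1 ξ₂)⁻¹) *
        ((E 0 * E 1) * (1 + β • ((1 / ξ₂) • pd 0 + (1 / ξ₁) • pd 1))))

/-- `S_β = S₀ + β T`. -/
def opS (ξ₁ ξ₂ β : ℂ) : Op := opS₀ ξ₁ ξ₂ + β • opT ξ₁ ξ₂ β

end

end SatoExample

namespace SatoExample

noncomputable section

open MvPolynomial Finset.HasAntidiagonal

/-! Everything rests on making the right action concrete. Modulo 𝔪𝔖, `f ∘ (a ∂ᵏ)` is `zᵏ · a(∂/∂z)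
f`: coefficients act by differentiation (`act`), powers of ∂ by multiplication, and `E i` acts as
the substitution zᵢ = 0 (`rightAct_E`). On polynomials ξᵢ - ∂/∂zᵢ is invertible, so every f is (ξ₁ -
∂/∂z₁)(ξ₂ - ∂/∂z₂) g, and in terms of g the action of S_β has no denominators (`rightAct_opS`).

The three descriptions of W_β are compared in a cycle: explicit space ⊆ image of S_β
(`explicitW_le_range`) ⊆ module (`range_le_moduleW`) ⊆ explicit space (`moduleW_le_explicitW`). The
last inclusion removes the constant term with w, then corrects the normal derivatives on the two
coordinate lines, until what remains is divisible by z₁²z₂².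

The symbol of S_β is f ↦ z₁z₂ f + β(ξ₂⁻² z₁² f(z₁,0) + ξ₁⁻² z₂² f(0,z₂)). It is injective, as
restriction to the two lines shows. A regular operator of order μ raises degrees by exactly μ, so
membership in the Grassmannian follows from the Sato property (`IsSatoOperator.isInGr`).

For the Cohen–Macaulay property, a maximal ideal of A is given by a point (a, b), has height 2, and
contains z₁² - a², z₂² - b². These form a weakly regular sequence on W_β, because the first factor
respects the condition on the line z₂ = 0 and the second the one on z₁ = 0.

If β ≠ 0, all elements of W_β vanish at (-ξ₂/β, 0). A dual basis would provide n in W_β and s in R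
with s n = F z₁², where F is nonzero at that point, which is impossible. -/

/-! ### Coefficients of the right action -/

/-- The product `k₁! k₂!`. -/
def factorial₂ (k : Expo) : ℂ := (k 0).factorial * (k 1).factorial

theorem factorial₂_ne_zero (k : Expo) : factorial₂ k ≠ 0 :=
  mul_ne_zero (by exact_mod_cast Nat.factorial_ne_zero _) (by exact_mod_cast Nat.factorial_ne_zero _)

theorem coeff_pderiv_iterate (a : Fin 2) (n : ℕ) (f : PS) (v : Expo) :
    MvPowerSeries.coeff v ((MvPowerSeries.pderiv ℂ a)^[n] f) =
      (v a + n).factorial / (v a).factorial * MvPowerSeries.coeff (v + Finsupp.single a n) f := by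
  induction n generalizing v with
  | zero =>
    have : ((v a).factorial : ℂ) ≠ 0 := by exact_mod_cast Nat.factorial_ne_zero _
    simp [this]
  | succ n ih =>
    have h1 : ((v a).factorial : ℂ) ≠ 0 := by exact_mod_cast Nat.factorial_ne_zero _
    have h2 : ((v a : ℂ) + 1) ≠ 0 := by exact_mod_cast (v a).succ_ne_zero
    rw [Function.iterate_succ_apply', MvPowerSeries.coeff_pderiv, ih]
    rw [add_assoc, ← Finsupp.single_add, add_comm 1 n]
    simp only [Finsupp.add_apply, Finsupp.single_eq_same, Nat.factorial_succ]
    rw [show v a + 1 + n = v a + (n + 1) by ring]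
    push_cast
    field_simp

theorem coeff_zero_iterD (i : Expo) (f : PS) :
    MvPowerSeries.coeff 0 (iterD i f) = factorial₂ i * MvPowerSeries.coeff i f := by
  have hi : Finsupp.single 0 (i 0) + Finsupp.single 1 (i 1) = i := by
    ext a; fin_cases a <;> simp
  rw [iterD, coeff_pderiv_iterate, coeff_pderiv_iterate, zero_add, hi]
  simp [factorial₂, mul_assoc]

theorem finite_degree_le (n : ℕ) : {k : Expo | k.degree ≤ n}.Finite := by
  refine (Set.finite_Iic (Finsupp.single 0 n + Finsupp.single 1 n : Expo)).subset ?_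
  intro k hk a
  have h1 : k a ≤ k.degree := Finsupp.le_degree a k
  have h2 : k.degree ≤ n := hk
  fin_cases a <;> simp at h1 ⊢ <;> omega

/-- A `finsum` with infinite support is 0 by default. Finite order excludes this: a term with
nonzero constant coefficient has |k| at most the order. -/
theorem coeff_atZero (P : Op) (j : Expo) :
    coeff j (atZero P) = MvPowerSeries.constantCoeff (P.1 j) := by
  have hfin : (Function.support fun k : Expo =>
      monomial k (MvPowerSeries.constantCoeff (P.1 k))).Finite := by
    obtain ⟨d, hd⟩ := P.2
    refine (finite_degree_le d.toNat).subset ?_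
    intro k hk
    have h : MvPowerSeries.coeff 0 (P.1 k) ≠ 0 := by
      intro h0
      apply hk
      rw [MvPowerSeries.coeff_zero_eq_constantCoeff] at h0
      simp [h0]
    have := hd ⟨k, 0, h, rfl⟩
    simp only [map_zero, Nat.cast_zero, sub_zero] at this
    simp only [Set.mem_ofPred_eq]
    omega
  rw [atZero, ← lcoeff_apply (R := ℂ), map_finsum _ hfin, finsum_eq_single _ j]
  · simp
  · intro k hk
    simp [coeff_monomial, hk]

/-- The coefficients of `ofPoly f` are constants, so at x = 0 only the coefficient of xⁱ in `P`
survives ∂ⁱ, with factor i!. Together with the binomials this is (p+i)!/p!, the effect of (∂/∂z)ⁱ on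
z^(p+i). -/
theorem coeff_rightAct_eq_finsum (f : Poly) (P : Op) (j : Expo) :
    coeff j (rightAct f P) = ∑ p ∈ antidiagonal j, ∑ᶠ i : Expo,
      factorial₂ (p.1 + i) / factorial₂ p.1 *
        (coeff (p.1 + i) f * MvPowerSeries.coeff i (P.1 p.2)) := by
  rw [rightAct, coeff_atZero]
  refine Finset.sum_congr rfl fun p _ => finsum_congr fun i => ?_
  change _ * MvPowerSeries.coeff 0 (MvPowerSeries.C (coeff (p.1 + i) f) * _) = _
  rw [MvPowerSeries.coeff_C_mul, coeff_zero_iterD]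
  have h := factorial₂_ne_zero p.1
  have e : (((p.1 + i) 0).choose (i 0) * ((p.1 + i) 1).choose (i 1) : ℂ) * factorial₂ i
      * factorial₂ p.1 = factorial₂ (p.1 + i) := by
    have c0 := Nat.add_choose_mul_factorial_mul_factorial (p.1 0) (i 0)
    have c1 := Nat.add_choose_mul_factorial_mul_factorial (p.1 1) (i 1)
    simp only [factorial₂, Finsupp.add_apply]
    rw [← c0, ← c1]
    push_cast
    ring
  rw [← e]
  field_simp

/-- Additivity of `finsum` needs finite supports; here they come from `f` being a polynomial. -/
theorem finite_support_shift (f : Poly) (p : Expo) (c : Expo → ℂ) (w : Expo → ℂ) :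
    (Function.support fun i : Expo => w i * (coeff (p + i) f * c i)).Finite := by
  refine (f.support.finite_toSet.preimage ((add_right_injective p).injOn)).subset ?_
  intro i hi
  simp only [Function.mem_support] at hi
  simp only [Set.mem_preimage, Finset.mem_coe, mem_support_iff]
  exact left_ne_zero_of_mul (right_ne_zero_of_mul hi)

theorem rightAct_add (f g : Poly) (P : Op) :
    rightAct (f + g) P = rightAct f P + rightAct g P := by
  ext j
  simp only [coeff_add, coeff_rightAct_eq_finsum, add_mul, mul_add, ← Finset.sum_add_distrib]
  refine Finset.sum_congr rfl fun p _ => ?_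
  rw [finsum_add_distrib (finite_support_shift _ _ _ _) (finite_support_shift _ _ _ _)]

theorem rightAct_smul (c : ℂ) (f : Poly) (P : Op) :
    rightAct (c • f) P = c • rightAct f P := by
  ext j
  simp only [coeff_smul, coeff_rightAct_eq_finsum, smul_eq_mul, Finset.mul_sum]
  refine Finset.sum_congr rfl fun p _ => ?_
  rw [← smul_eq_mul, smul_finsum]
  exact finsum_congr fun i => by simp only [smul_eq_mul]; ring

theorem rightAct_op_add (f : Poly) (P Q : Op) :
    rightAct f (P + Q) = rightAct f P + rightAct f Q := by
  ext j
  simp only [coeff_add, coeff_rightAct_eq_finsum, ← Finset.sum_add_distrib, Submodule.coe_add,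
    Pi.add_apply, map_add, mul_add]
  refine Finset.sum_congr rfl fun p _ => ?_
  rw [finsum_add_distrib (finite_support_shift _ _ _ _) (finite_support_shift _ _ _ _)]

theorem rightAct_op_smul (c : ℂ) (f : Poly) (P : Op) :
    rightAct f (c • P) = c • rightAct f P := by
  ext j
  simp only [coeff_smul, coeff_rightAct_eq_finsum, smul_eq_mul, Finset.mul_sum]
  refine Finset.sum_congr rfl fun p _ => ?_
  rw [← smul_eq_mul, smul_finsum]
  refine finsum_congr fun i => ?_
  simp only [Submodule.coe_smul, Pi.smul_apply, MvPowerSeries.coeff_smul, smul_eq_mul]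
  ring

theorem rightAct_op_zero (f : Poly) : rightAct f 0 = 0 := by
  simpa using rightAct_op_smul 0 f 0

/-- The right action of a fixed operator, as a linear map. -/
def rightActₗ (P : Op) : Poly →ₗ[ℂ] Poly where
  toFun f := rightAct f P
  map_add' f g := rightAct_add f g P
  map_smul' c f := rightAct_smul c f P

theorem rightActₗ_apply (P : Op) (f : Poly) : rightActₗ P f = rightAct f P := rfl

/-! ### The action of power series by differentiation -/

/-- The power series `a(x)` acts on polynomials as the differential operator `a(∂/∂z)`. -/
def act (a : PS) : Poly →ₗ[ℂ] Poly := rightActₗ (fn a)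

theorem rightAct_fn (f : Poly) (a : PS) : rightAct f (fn a) = act a f := rfl

theorem coeff_act (a : PS) (f : Poly) (p : Expo) :
    coeff p (act a f) = ∑ᶠ i : Expo, factorial₂ (p + i) / factorial₂ p *
      (coeff (p + i) f * MvPowerSeries.coeff i a) := by
  rw [← rightAct_fn, coeff_rightAct_eq_finsum, Finset.sum_eq_single (p, 0)]
  · simp [fn]
  · rintro ⟨r, l⟩ h h'
    have hl : l ≠ 0 := by
      rintro rfl
      rw [mem_antidiagonal] at h
      simp at h
      exact h' (by rw [h])
    simp [fn, hl]
  · simp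

/-- Only the coefficients of `P` act by differentiation, `∂ᵏ` acts by multiplication. -/
theorem coeff_rightAct (f : Poly) (P : Op) (j : Expo) :
    coeff j (rightAct f P) = ∑ p ∈ antidiagonal j, coeff p.1 (act (P.1 p.2) f) := by
  simp only [coeff_rightAct_eq_finsum, coeff_act]

theorem coeff_act_monomial (a : PS) (m : Expo) (c : ℂ) (p : Expo) :
    coeff p (act a (monomial m c)) =
      if p ≤ m then factorial₂ m / factorial₂ p * (c * MvPowerSeries.coeff (m - p) a) else 0 := by
  rw [coeff_act, finsum_eq_single _ (m - p)]
  · split_ifs with h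
    · rw [add_tsub_cancel_of_le h]; simp
    · rw [coeff_monomial, if_neg]
      · simp
      · intro h'
        exact h (h' ▸ le_self_add)
  · intro i hi
    rw [coeff_monomial, if_neg]
    · simp
    · rintro rfl
      exact hi (by simp)

theorem act_monomial (a : PS) (m : Expo) (c : ℂ) :
    act a (monomial m c) = ∑ q ∈ antidiagonal m,
      monomial q.1 (factorial₂ m / factorial₂ q.1 * (c * MvPowerSeries.coeff q.2 a)) := by
  ext p
  rw [coeff_act_monomial, coeff_sum]
  split_ifs with h
  · rw [Finset.sum_eq_single (p, m - p)]
    · simp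
    · rintro ⟨r, l⟩ hrl hne
      rw [coeff_monomial, if_neg]
      rintro rfl
      rw [mem_antidiagonal] at hrl
      apply hne
      simp only at hrl
      rw [← hrl]; simp
    · intro h'
      rw [mem_antidiagonal] at h'
      exact absurd (add_tsub_cancel_of_le h) h'
  · symm
    apply Finset.sum_eq_zero
    rintro ⟨r, l⟩ hrl
    rw [coeff_monomial, if_neg]
    rintro rfl
    rw [mem_antidiagonal] at hrl
    exact h (hrl ▸ le_self_add)

theorem sum_antidiagonal_assoc {M : Type*} [AddCommMonoid M] (n : Expo)
    (F : Expo → Expo → Expo → M) :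
    ∑ p ∈ antidiagonal n, ∑ q ∈ antidiagonal p.1, F q.1 q.2 p.2 =
      ∑ p ∈ antidiagonal n, ∑ q ∈ antidiagonal p.2, F p.1 q.1 q.2 := by
  rw [Finset.sum_sigma', Finset.sum_sigma']
  refine Finset.sum_nbij' (fun x => ⟨(x.2.1, x.2.2 + x.1.2), (x.2.2, x.1.2)⟩)
    (fun x => ⟨(x.1.1 + x.2.1, x.2.2), (x.1.1, x.2.1)⟩) ?_ ?_ ?_ ?_ ?_ <;>
    rintro ⟨⟨a, b⟩, ⟨c, d⟩⟩ h <;>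
    simp only [Finset.mem_sigma, mem_antidiagonal] at h ⊢ <;> obtain ⟨rfl, rfl⟩ := h <;>
    simp [add_assoc]

/-- Differential operators with constant coefficients compose like their symbols. Consequently an
inverse power series acts as the inverse operator. -/
theorem act_mul (a b : PS) (f : Poly) : act (a * b) f = act a (act b f) := by
  induction f using MvPolynomial.induction_on' with
  | add p q hp hq => simp only [map_add, hp, hq]
  | monomial m c =>
    have key := sum_antidiagonal_assoc m fun x y z => (monomial x (factorial₂ m / factorial₂ x *
      (c * (MvPowerSeries.coeff y a * MvPowerSeries.coeff z b))) : Poly)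
    rw [act_monomial, act_monomial, map_sum]
    simp only [act_monomial, MvPowerSeries.coeff_mul, Finset.mul_sum, map_sum]
    rw [← key]
    refine Finset.sum_congr rfl fun p _ => Finset.sum_congr rfl fun q _ => ?_
    congr 1
    have := factorial₂_ne_zero p.1
    field_simp

theorem act_add_left (a b : PS) (f : Poly) : act (a + b) f = act a f + act b f := by
  ext p
  simp only [coeff_act, coeff_add, map_add, mul_add]
  rw [finsum_add_distrib (finite_support_shift _ _ _ _) (finite_support_shift _ _ _ _)]

theorem act_C_mul (c : ℂ) (a : PS) (f : Poly) :
    act (MvPowerSeries.C c * a) f = c • act a f := by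
  ext p
  rw [coeff_smul, coeff_act, coeff_act, smul_finsum]
  refine finsum_congr fun i => ?_
  rw [MvPowerSeries.coeff_C_mul, smul_eq_mul]
  ring

theorem act_zero_left (f : Poly) : act 0 f = 0 := by
  simpa using act_C_mul 0 0 f

theorem act_sub_left (a b : PS) (f : Poly) : act (a - b) f = act a f - act b f := by
  have := act_add_left (a - b) b f
  rw [sub_add_cancel] at this
  rw [this, add_sub_cancel_right]

theorem act_one (f : Poly) : act 1 f = f := by
  ext p
  rw [coeff_act, finsum_eq_single _ 0]
  · simp [factorial₂_ne_zero]
  · intro i hi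
    rw [MvPowerSeries.coeff_one, if_neg hi]
    simp

theorem act_C (c : ℂ) (f : Poly) : act (MvPowerSeries.C c) f = c • f := by
  have := act_C_mul c 1 f
  rwa [mul_one, act_one] at this

theorem act_sum {ι : Type*} (s : Finset ι) (a : ι → PS) (f : Poly) :
    act (∑ i ∈ s, a i) f = ∑ i ∈ s, act (a i) f := by
  classical
  induction s using Finset.induction_on with
  | empty => simp [act_zero_left]
  | insert i s hi ih => rw [Finset.sum_insert hi, Finset.sum_insert hi, act_add_left, ih]

theorem act_X (i : Fin 2) (f : Poly) : act (MvPowerSeries.X i) f = pderiv i f := by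
  ext p
  rw [coeff_act, finsum_eq_single _ (Finsupp.single i 1), coeff_pderiv]
  · rw [MvPowerSeries.coeff_X, if_pos rfl, mul_one, mul_comm]
    congr 1
    rw [div_eq_iff (factorial₂_ne_zero p)]
    fin_cases i <;> simp [factorial₂, Nat.factorial_succ] <;> ring
  · intro q hq
    rw [MvPowerSeries.coeff_X, if_neg hq]
    simp

/-! ### Products in which no differentiation takes place -/

/-- If every Leibniz term with i ≠ 0 vanishes, the product is the Cauchy product in ∂. All explicit
products below are of this kind. -/
theorem mul_apply_of_commute {P Q : Op}
    (h : ∀ r i l : Expo, i ≠ 0 → P.1 (r + i) * iterD i (Q.1 l) = 0) (j : Expo) :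
    (P * Q).1 j = ∑ p ∈ antidiagonal j, P.1 p.1 * Q.1 p.2 := by
  ext s
  rw [map_sum]
  refine Finset.sum_congr rfl fun p _ => ?_
  rw [finsum_eq_single _ 0]
  · simp [iterD]
  · intro i hi
    rw [h _ _ _ hi, LinearMap.map_zero, mul_zero]

theorem fn_mul_apply (a : PS) (Q : Op) (j : Expo) : (fn a * Q).1 j = a * Q.1 j := by
  rw [mul_apply_of_commute, Finset.sum_eq_single (0, j)]
  · simp [fn]
  · rintro ⟨r, l⟩ h h'
    have hr : r ≠ 0 := by
      rintro rfl
      rw [mem_antidiagonal] at h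
      simp only [zero_add] at h
      exact h' (by rw [h])
    simp [fn, hr]
  · simp
  · intro r i l hi
    have : r + i ≠ 0 := fun h => hi (by simpa using (add_eq_zero.mp h).2)
    simp [fn, this]

theorem iterD_C (i : Expo) (hi : i ≠ 0) (c : ℂ) : iterD i (MvPowerSeries.C c) = 0 := by
  ext v
  by_contra h
  have := coeff_iterD_ne i _ v h
  rw [MvPowerSeries.coeff_C, if_neg] at this
  · exact this rfl
  · exact fun h => hi (by simpa using (add_eq_zero.mp h).2)

theorem mul_ofPoly_apply (P : Op) (h : Poly) (j : Expo) :
    (P * ofPoly h).1 j =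
      ∑ p ∈ antidiagonal j, MvPowerSeries.C (coeff p.2 h) * P.1 p.1 := by
  rw [mul_apply_of_commute]
  · exact Finset.sum_congr rfl fun p _ => mul_comm _ _
  · intro r i l hi
    simp [ofPoly, iterD_C i hi]

theorem rightAct_fn_mul (f : Poly) (a : PS) (Q : Op) :
    rightAct f (fn a * Q) = rightAct (act a f) Q := by
  ext j
  simp only [coeff_rightAct, fn_mul_apply, mul_comm a, act_mul]

theorem rightAct_mul_ofPoly (f : Poly) (P : Op) (h : Poly) :
    rightAct f (P * ofPoly h) = rightAct f P * h := by
  ext j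
  simp only [coeff_rightAct, mul_ofPoly_apply, act_sum, act_C_mul, coeff_sum, coeff_mul,
    coeff_smul, Finset.sum_mul]
  rw [sum_antidiagonal_assoc j fun x y z => coeff x (act (P.1 y) f) * coeff z h]
  exact Finset.sum_congr rfl fun p _ => Finset.sum_congr rfl fun q _ => mul_comm _ _

theorem rightAct_ofPoly (f h : Poly) : rightAct f (ofPoly h) = f * h := by
  ext j
  rw [coeff_rightAct, coeff_mul]
  refine Finset.sum_congr rfl fun p _ => ?_
  change coeff p.1 (act (MvPowerSeries.C (coeff p.2 h)) f) = _
  rw [act_C, coeff_smul, smul_eq_mul, mul_comm]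

theorem ofPoly_mul (f h : Poly) : ofPoly f * ofPoly h = ofPoly (f * h) := by
  refine Subtype.ext (funext fun j => ?_)
  rw [mul_ofPoly_apply]
  simp only [ofPoly, coeff_mul, map_sum, map_mul]
  exact Finset.sum_congr rfl fun p _ => mul_comm _ _

theorem ofPoly_add (f h : Poly) : ofPoly f + ofPoly h = ofPoly (f + h) := by
  refine Subtype.ext (funext fun j => ?_)
  simp [ofPoly]

theorem ofPoly_smul (c : ℂ) (h : Poly) : c • ofPoly h = ofPoly (c • h) := by
  refine Subtype.ext (funext fun j => ?_)
  simp only [ofPoly, Submodule.coe_smul, Pi.smul_apply, coeff_smul, smul_eq_mul, map_mul]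
  rw [MvPowerSeries.smul_eq_C_mul]

theorem ofPoly_one : (1 : Op) = ofPoly 1 := by
  refine Subtype.ext (funext fun j => ?_)
  change (if j = 0 then (1 : PS) else 0) = MvPowerSeries.C (coeff j 1)
  rw [coeff_one]
  by_cases h : j = 0
  · simp [h]
  · simp [h, Ne.symm h]

/-! ### The delta-function operators -/

/-- The substitution `zᵢ = 0`. -/
def eraseVar (i : Fin 2) : Poly →ₐ[ℂ] Poly := aeval fun j => if j = i then 0 else X j

@[simp] theorem eraseVar_C (i : Fin 2) (c : ℂ) : eraseVar i (C c) = C c := by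
  simp [eraseVar, algebraMap_eq]

@[simp] theorem eraseVar_X_self (i : Fin 2) : eraseVar i (X i) = 0 := by simp [eraseVar]

@[simp] theorem eraseVar_zero_X_one : eraseVar 0 (X 1) = X 1 := by simp [eraseVar]

@[simp] theorem eraseVar_one_X_zero : eraseVar 1 (X 0) = X 0 := by simp [eraseVar]

theorem monomial_eq_mul (m : Expo) (c : ℂ) :
    (monomial m c : Poly) = C c * (X 0 ^ m 0 * X 1 ^ m 1) := by
  rw [monomial_eq, Finsupp.prod_fintype _ _ (fun i => pow_zero _), Fin.prod_univ_two]

theorem eraseVar_monomial (i : Fin 2) (m : Expo) (c : ℂ) :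
    eraseVar i (monomial m c) = if m i = 0 then monomial m c else 0 := by
  rw [monomial_eq_mul]
  split_ifs with h
  · fin_cases i <;> simp at h <;> simp [h]
  · fin_cases i <;> simp at h <;> simp [h]

/-- Each xᵏ(∂/∂x)ᵏ is of Euler type, so monomials are eigenvectors. -/
theorem rightAct_monomial_of_diagonal {P : Op} {c : Expo → ℂ}
    (hP : ∀ k, P.1 k = MvPowerSeries.monomial k (c k)) (m : Expo) (a : ℂ) :
    rightAct (monomial m a) P =
      (∑ q ∈ antidiagonal m, factorial₂ m / factorial₂ q.1 * c q.2) • monomial m a := by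
  ext j
  rw [coeff_rightAct, coeff_smul, coeff_monomial]
  simp only [coeff_act_monomial, hP, MvPowerSeries.coeff_monomial]
  split_ifs with h
  · subst h
    rw [smul_eq_mul, Finset.sum_mul]
    refine Finset.sum_congr rfl fun q hq => ?_
    rw [mem_antidiagonal] at hq
    rw [if_pos (hq ▸ le_self_add), if_pos (by rw [← hq]; simp)]
    ring
  · rw [smul_zero]
    refine Finset.sum_eq_zero fun q hq => ?_
    rw [mem_antidiagonal] at hq
    split_ifs with h1 h2
    · exact absurd (by rw [← hq, ← h2, add_tsub_cancel_of_le h1]) h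
    · simp
    · rfl

theorem sum_antidiagonal_expo (m : Expo) (F G : ℕ → ℕ → ℂ) :
    ∑ q ∈ antidiagonal m, F (q.1 0) (q.2 0) * G (q.1 1) (q.2 1) =
      (∑ x ∈ antidiagonal (m 0), F x.1 x.2) * ∑ y ∈ antidiagonal (m 1), G y.1 y.2 := by
  rw [Finset.sum_mul_sum, ← Finset.sum_product']
  refine Finset.sum_nbij' (fun q => ((q.1 0, q.2 0), (q.1 1, q.2 1)))
    (fun x => (Finsupp.single 0 x.1.1 + Finsupp.single 1 x.2.1,
      Finsupp.single 0 x.1.2 + Finsupp.single 1 x.2.2)) ?_ ?_ ?_ ?_ ?_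
  · rintro q hq
    rw [mem_antidiagonal] at hq
    simp [← hq]
  · rintro x hx
    simp only [Finset.mem_product, mem_antidiagonal] at hx ⊢
    ext a
    fin_cases a <;> simp [← hx.1, ← hx.2]
  · rintro q -
    refine Prod.ext ?_ ?_ <;> ext a <;> fin_cases a <;> simp
  · rintro x -
    simp
  · rintro q -
    rfl

/-- This is the binomial expansion of (1 - 1)ⁿ, the eigenvalue of a delta-function operator on zⁿ.
-/
theorem sum_factorial_div_mul_alternating (n : ℕ) :
    ∑ x ∈ antidiagonal n, (n.factorial : ℂ) / x.1.factorial *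
      ((x.2.factorial : ℂ)⁻¹ * (-1) ^ x.2) = if n = 0 then 1 else 0 := by
  have h := (Commute.one_left (-1 : ℂ)).add_pow' n
  rw [add_neg_cancel, zero_pow_eq] at h
  rw [h]
  refine Finset.sum_congr rfl fun x hx => ?_
  have hx' : x.1 + x.2 = n := by simpa using hx
  have c := Nat.add_choose_mul_factorial_mul_factorial x.2 x.1
  rw [add_comm, hx'] at c
  rw [← c, one_pow, one_mul, nsmul_eq_mul]
  have h1 : (x.1.factorial : ℂ) ≠ 0 := by exact_mod_cast x.1.factorial_ne_zero
  have h2 : (x.2.factorial : ℂ) ≠ 0 := by exact_mod_cast x.2.factorial_ne_zero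
  push_cast
  field_simp

theorem sum_factorial_div_mul_ite (n : ℕ) :
    ∑ x ∈ antidiagonal n, (n.factorial : ℂ) / x.1.factorial * (if x.2 = 0 then 1 else 0) = 1 := by
  rw [Finset.sum_eq_single (n, 0)]
  · have : (n.factorial : ℂ) ≠ 0 := by exact_mod_cast n.factorial_ne_zero
    simp [this]
  · rintro ⟨r, l⟩ h h'
    have hl : l ≠ 0 := by
      rintro rfl
      simp at h
      exact h' (by rw [h])
    simp [hl]
  · simp

theorem neg_X_pow (i : Fin 2) (n : ℕ) : (-MvPowerSeries.X i : PS) ^ n =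
    MvPowerSeries.monomial (Finsupp.single i n) ((-1) ^ n) := by
  rw [neg_pow, MvPowerSeries.X_pow_eq, ← map_one MvPowerSeries.C, ← map_neg, ← map_pow,
    ← MvPowerSeries.smul_eq_C_mul, ← map_smul, smul_eq_mul, mul_one]

/-- The coefficients of `exp (-xᵢ * ∂ᵢ)`. -/
def expNegCoeff (n : ℕ) : ℂ := (n.factorial : ℂ)⁻¹ * (-1) ^ n

theorem E_apply (i : Fin 2) (k : Expo) : (E i).1 k = MvPowerSeries.monomial k
    (if k = Finsupp.single i (k i) then expNegCoeff (k i) else 0) := by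
  change (if k = Finsupp.single i (k i) then _ else 0) = _
  split_ifs with h
  · rw [neg_X_pow, ← h, ← MvPowerSeries.smul_eq_C_mul, ← map_smul]
    rfl
  · simp

theorem E_zero_apply (k : Expo) : (E 0).1 k = MvPowerSeries.monomial k
    (expNegCoeff (k 0) * if k 1 = 0 then 1 else 0) := by
  rw [E_apply]
  congr 1
  by_cases h : k 1 = 0
  · rw [if_pos h, if_pos, mul_one]
    ext a; fin_cases a <;> simp [h]
  · rw [if_neg h, if_neg, mul_zero]
    intro h'
    exact h (by rw [h']; simp)

theorem E_one_apply (k : Expo) : (E 1).1 k = MvPowerSeries.monomial k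
    ((if k 0 = 0 then 1 else 0) * expNegCoeff (k 1)) := by
  rw [E_apply]
  congr 1
  by_cases h : k 0 = 0
  · rw [if_pos h, if_pos, one_mul]
    ext a; fin_cases a <;> simp [h]
  · rw [if_neg h, if_neg, zero_mul]
    intro h'
    exact h (by rw [h']; simp)

theorem E_zero_mul_E_one_apply (k : Expo) : (E 0 * E 1).1 k = MvPowerSeries.monomial k
    (expNegCoeff (k 0) * expNegCoeff (k 1)) := by
  rw [mul_apply_of_commute]
  · simp only [E_zero_apply, E_one_apply, MvPowerSeries.monomial_mul_monomial]
    rw [Finset.sum_eq_single (Finsupp.single 0 (k 0), Finsupp.single 1 (k 1))]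
    · have : Finsupp.single 0 (k 0) + Finsupp.single 1 (k 1) = k := by
        ext a; fin_cases a <;> simp
      simp [this]
    · rintro ⟨r, l⟩ h h'
      rw [mem_antidiagonal] at h
      by_cases h1 : r 1 = 0
      · by_cases h0 : l 0 = 0
        · exfalso
          apply h'
          simp only at h
          refine Prod.ext ?_ ?_ <;> ext a <;> fin_cases a <;> simp [← h, h0, h1]
        · simp [h0]
      · simp [h1]
    · intro h
      exfalso
      apply h
      rw [mem_antidiagonal]
      ext a; fin_cases a <;> simp
  -- `E 0` contains only powers of ∂₁ and the coefficients of `E 1` involve only x₂, so no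
  -- derivative contributes.
  · intro r i l hi
    by_cases h1 : i 1 = 0
    · have h0 : i 0 ≠ 0 := fun h0 => hi (by ext a; fin_cases a <;> simp [h0, h1])
      suffices iterD i ((E 1).1 l) = 0 by rw [this, mul_zero]
      ext v
      by_contra h
      have := coeff_iterD_ne i _ v h
      rw [E_one_apply, MvPowerSeries.coeff_monomial] at this
      split_ifs at this with h2 h3
      · rw [← h2] at h3
        simp [h0] at h3
      · simp at this
      · simp at this
    · rw [E_zero_apply]
      simp [h1]

theorem rightAct_eq_of_monomial {P : Op} {F : Poly →ₗ[ℂ] Poly}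
    (h : ∀ m c, rightAct (monomial m c) P = F (monomial m c)) (f : Poly) :
    rightAct f P = F f := by
  induction f using MvPolynomial.induction_on' with
  | add p q hp hq => rw [rightAct_add, hp, hq, map_add]
  | monomial m c => exact h m c

theorem rightAct_diagonal_monomial {P : Op} {F G : ℕ → ℂ}
    (hP : ∀ k, P.1 k = MvPowerSeries.monomial k (F (k 0) * G (k 1))) (m : Expo) (a : ℂ) :
    rightAct (monomial m a) P =
      ((∑ x ∈ antidiagonal (m 0), ((m 0).factorial : ℂ) / x.1.factorial * F x.2) *
        ∑ x ∈ antidiagonal (m 1), ((m 1).factorial : ℂ) / x.1.factorial * G x.2) •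
          monomial m a := by
  rw [rightAct_monomial_of_diagonal hP, ← sum_antidiagonal_expo m
    (fun x y => ((m 0).factorial : ℂ) / x.factorial * F y)
    (fun x y => ((m 1).factorial : ℂ) / x.factorial * G y)]
  congr 1
  refine Finset.sum_congr rfl fun q _ => ?_
  simp only [factorial₂]
  rw [mul_div_mul_comm]
  ring

theorem rightAct_E (i : Fin 2) (f : Poly) : rightAct f (E i) = eraseVar i f := by
  refine rightAct_eq_of_monomial (F := (eraseVar i).toLinearMap) (fun m c => ?_) f
  rw [AlgHom.toLinearMap_apply, eraseVar_monomial]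
  fin_cases i
  · change rightAct _ (E 0) = if m 0 = 0 then _ else _
    rw [rightAct_diagonal_monomial (F := expNegCoeff) (G := fun n => if n = 0 then 1 else 0)
      E_zero_apply, sum_factorial_div_mul_ite]
    simp only [expNegCoeff]
    rw [sum_factorial_div_mul_alternating]
    split_ifs <;> simp
  · change rightAct _ (E 1) = if m 1 = 0 then _ else _
    rw [rightAct_diagonal_monomial (F := fun n => if n = 0 then 1 else 0) (G := expNegCoeff)
      E_one_apply, sum_factorial_div_mul_ite]
    simp only [expNegCoeff]
    rw [sum_factorial_div_mul_alternating]
    split_ifs <;> simp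

theorem rightAct_E_mul_E (f : Poly) : rightAct f (E 0 * E 1) = eraseVar 0 (eraseVar 1 f) := by
  refine rightAct_eq_of_monomial
    (F := (eraseVar 0).toLinearMap ∘ₗ (eraseVar 1).toLinearMap) (fun m c => ?_) f
  rw [LinearMap.comp_apply, AlgHom.toLinearMap_apply, AlgHom.toLinearMap_apply, eraseVar_monomial,
    rightAct_diagonal_monomial E_zero_mul_E_one_apply]
  simp only [expNegCoeff]
  rw [sum_factorial_div_mul_alternating, sum_factorial_div_mul_alternating]
  by_cases h1 : m 1 = 0
  · rw [if_pos h1, if_pos h1, eraseVar_monomial]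
    split_ifs <;> simp
  · simp [h1]

/-! ### The right action of `S_β` -/

theorem act_shift (i : Fin 2) (ξ : ℂ) (f : Poly) :
    act (shift i ξ) f = C ξ * f - pderiv i f := by
  rw [shift, act_sub_left, act_C, act_X, smul_eq_C_mul]

theorem shift_mul_inv (i : Fin 2) {ξ : ℂ} (hξ : ξ ≠ 0) : shift i ξ * (shift i ξ)⁻¹ = 1 :=
  MvPowerSeries.mul_inv_cancel _ (by simpa [shift] using hξ)

/-- Writing the argument as (ξ₁ - ∂/∂z₁)(ξ₂ - ∂/∂z₂) g cancels every inverse series in S_β. -/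
theorem rightAct_opS {ξ₁ ξ₂ : ℂ} (h₁ : ξ₁ ≠ 0) (h₂ : ξ₂ ≠ 0) (β : ℂ) (g : Poly) :
    rightAct (act (shift 0 ξ₁ * shift 1 ξ₂) g) (opS ξ₁ ξ₂ β) =
      X 0 * X 1 * act (shift 0 ξ₁ * shift 1 ξ₂) g + X 0 * act (shift 0 ξ₁) g +
        X 1 * act (shift 1 ξ₂) g + g +
      C β * (C (1 / ξ₂) * (X 0 * eraseVar 1 g + X 0 ^ 2 * eraseVar 1 (act (shift 0 ξ₁) g)) +
        C (1 / ξ₁) * (X 1 * eraseVar 0 g + X 1 ^ 2 * eraseVar 0 (act (shift 1 ξ₂) g)) +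
        C (1 / (ξ₁ * ξ₂ - β)) * (eraseVar 0 (eraseVar 1 g) *
          (1 + C β * (C (1 / ξ₂) * X 0 + C (1 / ξ₁) * X 1)))) := by
  have e0 := shift_mul_inv 0 h₁
  have e1 := shift_mul_inv 1 h₂
  have a1 : act (shift 1 ξ₂)⁻¹ (act (shift 0 ξ₁ * shift 1 ξ₂) g) = act (shift 0 ξ₁) g := by
    rw [← act_mul]; congr 2; linear_combination shift 0 ξ₁ * e1
  have a0 : act (shift 0 ξ₁)⁻¹ (act (shift 0 ξ₁ * shift 1 ξ₂) g) = act (shift 1 ξ₂) g := by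
    rw [← act_mul]; congr 2; linear_combination shift 1 ξ₂ * e0
  have a01 : act ((shift 0 ξ₁)⁻¹ * (shift 1 ξ₂)⁻¹) (act (shift 0 ξ₁ * shift 1 ξ₂) g) = g := by
    rw [← act_mul]
    convert act_one g using 2
    congr 1
    linear_combination e0 * (shift 1 ξ₂ * (shift 1 ξ₂)⁻¹) + e1
  have p : (1 + β • ((1 / ξ₂) • pd 0 + (1 / ξ₁) • pd 1) : Op) =
      ofPoly (1 + β • ((1 / ξ₂) • X 0 + (1 / ξ₁) • X 1)) := by
    simp only [pd, ofPoly_one, ofPoly_smul, ofPoly_add]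
  simp only [opS, opS₀, opT, rightAct_op_add, rightAct_op_smul, rightAct_fn_mul, rightAct_fn, p,
    a0, a1, a01, rightAct_mul_ofPoly]
  simp only [pd, ofPoly_mul, rightAct_mul_ofPoly, rightAct_ofPoly, rightAct_E, rightAct_E_mul_E,
    smul_eq_C_mul]
  ring

/-! ### Substitution of zero -/

@[simp] theorem pderiv_zero_X_one : pderiv (0 : Fin 2) (X 1 : Poly) = 0 :=
  pderiv_X_of_ne (by decide)

@[simp] theorem pderiv_one_X_zero : pderiv (1 : Fin 2) (X 0 : Poly) = 0 :=
  pderiv_X_of_ne (by decide)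

theorem eraseVar_eraseVar (i : Fin 2) (f : Poly) : eraseVar i (eraseVar i f) = eraseVar i f := by
  induction f using MvPolynomial.induction_on' with
  | add p q hp hq => simp only [map_add, hp, hq]
  | monomial m c =>
    rw [eraseVar_monomial]
    split_ifs with h
    · rw [eraseVar_monomial, if_pos h]
    · simp

theorem eraseVar_comm (f : Poly) : eraseVar 1 (eraseVar 0 f) = eraseVar 0 (eraseVar 1 f) := by
  induction f using MvPolynomial.induction_on' with
  | add p q hp hq => simp only [map_add, hp, hq]
  | monomial m c =>
    rw [eraseVar_monomial, eraseVar_monomial]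
    split_ifs with h0 h1 h1 <;> simp [eraseVar_monomial, h0, h1]

theorem pderiv_eraseVar_self (i : Fin 2) (f : Poly) : pderiv i (eraseVar i f) = 0 := by
  induction f using MvPolynomial.induction_on' with
  | add p q hp hq => simp only [map_add, hp, hq, add_zero]
  | monomial m c =>
    rw [eraseVar_monomial]
    split_ifs with h
    · rw [pderiv_monomial, h]; simp
    · simp

theorem pderiv_eraseVar_of_ne {i j : Fin 2} (h : i ≠ j) (f : Poly) :
    pderiv i (eraseVar j f) = eraseVar j (pderiv i f) := by
  induction f using MvPolynomial.induction_on' with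
  | add p q hp hq => simp only [map_add, hp, hq]
  | monomial m c =>
    rw [eraseVar_monomial, pderiv_monomial, eraseVar_monomial]
    have e : (m - Finsupp.single i 1 : Expo) j = m j := by simp [h.symm]
    rw [e]
    split_ifs with h
    · rw [pderiv_monomial]
    · simp

@[simp] theorem pderiv_zero_eraseVar_one (f : Poly) :
    pderiv 0 (eraseVar 1 f) = eraseVar 1 (pderiv 0 f) := pderiv_eraseVar_of_ne (by decide) f

@[simp] theorem pderiv_one_eraseVar_zero (f : Poly) :
    pderiv 1 (eraseVar 0 f) = eraseVar 0 (pderiv 1 f) := pderiv_eraseVar_of_ne (by decide) f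

theorem X_dvd_sub_eraseVar (i : Fin 2) (f : Poly) : X i ∣ f - eraseVar i f := by
  induction f using MvPolynomial.induction_on' with
  | add p q hp hq =>
    rw [map_add, add_sub_add_comm]
    exact dvd_add hp hq
  | monomial m c =>
    rw [eraseVar_monomial]
    split_ifs with h
    · simp
    · rw [sub_zero, X_dvd_monomial]
      exact Or.inr h

theorem X_dvd_of_eraseVar_eq_zero {i : Fin 2} {f : Poly} (h : eraseVar i f = 0) : X i ∣ f := by
  simpa [h] using X_dvd_sub_eraseVar i f

theorem X_sq_dvd {i : Fin 2} {f : Poly} (h : eraseVar i f = 0) (h' : eraseVar i (pderiv i f) = 0) :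
    X i ^ 2 ∣ f := by
  obtain ⟨g, rfl⟩ := X_dvd_of_eraseVar_eq_zero h
  have hg : eraseVar i g = 0 := by
    simpa [pderiv_mul] using h'
  obtain ⟨k, rfl⟩ := X_dvd_of_eraseVar_eq_zero hg
  exact ⟨k, by ring⟩

/-- Factoring through ℂ[ρ] links equations in ℂ(ρ) to equations in R, and shows that the restriction
lies in ℂ[z₁]. -/
theorem eraseVar_one_eq (f : Poly) :
    eraseVar 1 f = Polynomial.aeval (X 0 : Poly) (aeval ![Polynomial.X, (0 : Polynomial ℂ)] f) := by
  rw [← AlgHom.comp_apply]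
  congr 1
  ext i
  fin_cases i <;> simp

theorem eraseVar_zero_eq (f : Poly) :
    eraseVar 0 f = Polynomial.aeval (X 1 : Poly) (aeval ![(0 : Polynomial ℂ), Polynomial.X] f) := by
  rw [← AlgHom.comp_apply]
  congr 1
  ext i
  fin_cases i <;> simp

theorem line₁_eq (f : Poly) : line₁ f =
    algebraMap (Polynomial ℂ) (RatFunc ℂ) (aeval ![Polynomial.X, (0 : Polynomial ℂ)] f) := by
  rw [← IsScalarTower.coe_toAlgHom' ℂ (Polynomial ℂ) (RatFunc ℂ), ← AlgHom.comp_apply]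
  congr 1
  ext i
  fin_cases i <;> simp [line₁]

theorem line₂_eq (f : Poly) : line₂ f =
    algebraMap (Polynomial ℂ) (RatFunc ℂ) (aeval ![(0 : Polynomial ℂ), Polynomial.X] f) := by
  rw [← IsScalarTower.coe_toAlgHom' ℂ (Polynomial ℂ) (RatFunc ℂ), ← AlgHom.comp_apply]
  congr 1
  ext i
  fin_cases i <;> simp [line₂]

theorem line₁_eraseVar (f : Poly) : line₁ (eraseVar 1 f) = line₁ f := by
  rw [← AlgHom.comp_apply]
  congr 1
  ext i
  fin_cases i <;> simp [line₁]

theorem line₂_eraseVar (f : Poly) : line₂ (eraseVar 0 f) = line₂ f := by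
  rw [← AlgHom.comp_apply]
  congr 1
  ext i
  fin_cases i <;> simp [line₂]

theorem line₁_eq_line₁_iff (f g : Poly) : line₁ f = line₁ g ↔ eraseVar 1 f = eraseVar 1 g := by
  constructor
  · intro h
    rw [line₁_eq, line₁_eq] at h
    rw [eraseVar_one_eq, eraseVar_one_eq, RatFunc.algebraMap_injective ℂ h]
  · intro h
    rw [← line₁_eraseVar, h, line₁_eraseVar]

theorem line₂_eq_line₂_iff (f g : Poly) : line₂ f = line₂ g ↔ eraseVar 0 f = eraseVar 0 g := by
  constructor
  · intro h
    rw [line₂_eq, line₂_eq] at h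
    rw [eraseVar_zero_eq, eraseVar_zero_eq, RatFunc.algebraMap_injective ℂ h]
  · intro h
    rw [← line₂_eraseVar, h, line₂_eraseVar]

/-! ### Membership in `W_β` -/

theorem linear_ne_zero {a : ℂ} (ha : a ≠ 0) (b : ℂ) (i : Fin 2) : (C a + C b * X i : Poly) ≠ 0 := by
  intro h
  have := congrArg (eraseVar i) h
  simp [ha] at this

theorem mul_eq_div_mul_iff {K : Type*} [Field K] {x d c a b : K} (hx : x ≠ 0) (hd : d ≠ 0) :
    x * a = c * x / d * b ↔ d * a = c * b := by
  field_simp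

theorem line₁_C (c : ℂ) : line₁ (C c) = RatFunc.C c := by
  rw [line₁_eq]; simp

theorem line₂_C (c : ℂ) : line₂ (C c) = RatFunc.C c := by
  rw [line₂_eq]; simp

theorem mem_moduleW {ξ₁ ξ₂ : ℂ} (h₁ : ξ₁ ≠ 0) (h₂ : ξ₂ ≠ 0) (β : ℂ) (f : Poly) :
    f ∈ moduleW ξ₁ ξ₂ β ↔
      (C ξ₂ + C β * X 0) * eraseVar 1 (pderiv 1 f) = C (ξ₂ ^ 2) * eraseVar 1 f ∧
      (C ξ₁ + C β * X 1) * eraseVar 0 (pderiv 0 f) = C (ξ₁ ^ 2) * eraseVar 0 f := by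
  have e₁ : line₁ (C ξ₂ + C β * X 0) = RatFunc.C ξ₂ + RatFunc.C β * RatFunc.X := by
    simp only [map_add, map_mul, line₁_C]
    simp [line₁]
  have e₂ : line₂ (C ξ₁ + C β * X 1) = RatFunc.C ξ₁ + RatFunc.C β * RatFunc.X := by
    simp only [map_add, map_mul, line₂_C]
    simp [line₂]
  have d₁ : RatFunc.C ξ₂ + RatFunc.C β * RatFunc.X ≠ 0 := by
    rw [← e₁, ← map_zero line₁, Ne, line₁_eq_line₁_iff]
    simpa using linear_ne_zero h₂ β 0
  have d₂ : RatFunc.C ξ₁ + RatFunc.C β * RatFunc.X ≠ 0 := by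
    rw [← e₂, ← map_zero line₂, Ne, line₂_eq_line₂_iff]
    simpa using linear_ne_zero h₁ β 1
  change RatFunc.X * line₁ (pderiv 1 f) = _ ∧ -RatFunc.X * line₂ (pderiv 0 f) = _ ↔ _
  rw [neg_mul, neg_mul, neg_inj, mul_eq_div_mul_iff RatFunc.X_ne_zero d₁,
    mul_eq_div_mul_iff RatFunc.X_ne_zero d₂, ← e₁, ← e₂, ← line₁_C, ← line₂_C, ← map_mul,
    ← map_mul, ← map_mul, ← map_mul, line₁_eq_line₁_iff, line₂_eq_line₂_iff]
  simp only [map_mul, map_add, eraseVar_C, eraseVar_zero_X_one, eraseVar_one_X_zero]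

theorem C_mul_C_one_div {a : ℂ} (ha : a ≠ 0) : (C a * C (1 / a) : Poly) = 1 := by
  rw [← C_mul, mul_one_div_cancel ha, C_1]

theorem pderiv_pderiv_comm (f : Poly) : pderiv 1 (pderiv 0 f) = pderiv 0 (pderiv 1 f) := by
  rw [← act_X, ← act_X, ← act_X, ← act_X, ← act_mul, mul_comm, act_mul]

/-- Put κ = ξ₁ξ₂ - β and, on z₂ = 0, Φ = z₁(ξ₁ - ∂/∂z₁)g + g + (β/κ) g(0,0). There the image f
restricts to (1 + βz₁/ξ₂)Φ and its normal derivative to ξ₂Φ; the constant terms agree because 1 +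
β/κ = ξ₁ξ₂/κ. The other line is symmetric. -/
theorem rightAct_opS_mem {ξ₁ ξ₂ β : ℂ} (h₁ : ξ₁ ≠ 0) (h₂ : ξ₂ ≠ 0) (hβ : ξ₁ * ξ₂ - β ≠ 0)
    (g : Poly) :
    rightAct (act (shift 0 ξ₁ * shift 1 ξ₂) g) (opS ξ₁ ξ₂ β) ∈ moduleW ξ₁ ξ₂ β := by
  have e1 := C_mul_C_one_div h₁
  have e2 := C_mul_C_one_div h₂
  have ek := C_mul_C_one_div hβ
  rw [C_sub, C_mul] at ek
  rw [mem_moduleW h₁ h₂, rightAct_opS h₁ h₂, act_mul]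
  simp only [act_shift, map_add, map_sub, map_mul, map_pow, pderiv_mul, pderiv_pow, pderiv_C, pderiv_X_self,
    pderiv_zero_X_one, pderiv_one_X_zero, pderiv_zero_eraseVar_one, pderiv_one_eraseVar_zero,
    pderiv_eraseVar_self, eraseVar_eraseVar, eraseVar_C, eraseVar_X_self, eraseVar_zero_X_one,
    eraseVar_one_X_zero, map_one, map_zero, eraseVar_comm, pderiv_one, zero_mul, mul_zero, zero_add, add_zero,
    pderiv_pderiv_comm]
  constructor
  · linear_combination (C ξ₂ + C β * X 0) * eraseVar 0 (eraseVar 1 g) * C β *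
      (-C (1 / ξ₁) * ek + C ξ₂ * C (1 / (ξ₁ * ξ₂ - β)) * e1) - C ξ₂ * C β * X 0 *
      (X 0 * (C ξ₁ * eraseVar 1 g - eraseVar 1 (pderiv 0 g)) + eraseVar 1 g +
        C β * C (1 / (ξ₁ * ξ₂ - β)) * eraseVar 0 (eraseVar 1 g)) * e2
  · linear_combination (C ξ₁ + C β * X 1) * eraseVar 0 (eraseVar 1 g) * C β *
      (-C (1 / ξ₂) * ek + C ξ₁ * C (1 / (ξ₁ * ξ₂ - β)) * e2) - C ξ₁ * C β * X 1 *
      (X 1 * (C ξ₂ * eraseVar 0 g - eraseVar 0 (pderiv 1 g)) + eraseVar 0 g +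
        C β * C (1 / (ξ₁ * ξ₂ - β)) * eraseVar 0 (eraseVar 1 g)) * e1

/-! ### The explicit description of `W_β` -/

/-- The generator `w` of `W_β`. -/
def genW (ξ₁ ξ₂ β : ℂ) : Poly :=
  1 + C ξ₁ * X 0 + C ξ₂ * X 1 + C (ξ₁ * ξ₂ - β) *
    (X 0 * X 1 + C β * (C (1 / ξ₂ ^ 2) * X 0 ^ 2 + C (1 / ξ₁ ^ 2) * X 1 ^ 2))

theorem eraseVar_of_mem_adjoin {i j : Fin 2} (h : j ≠ i) {q : Poly}
    (hq : q ∈ Algebra.adjoin ℂ {(X j : Poly)}) : eraseVar i q = q := by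
  induction hq using Algebra.adjoin_induction with
  | mem x hx => rw [Set.mem_singleton_iff.mp hx]; simp [eraseVar, h]
  | algebraMap r => simp [algebraMap_eq]
  | add x y _ _ hx hy => simp [hx, hy]
  | mul x y _ _ hx hy => simp [hx, hy]

theorem eraseVar_one_mem_adjoin (f : Poly) : eraseVar 1 f ∈ Algebra.adjoin ℂ {(X 0 : Poly)} := by
  rw [eraseVar_one_eq]
  exact Polynomial.aeval_mem_adjoin_singleton _ _

theorem eraseVar_zero_mem_adjoin (f : Poly) : eraseVar 0 f ∈ Algebra.adjoin ℂ {(X 1 : Poly)} := by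
  rw [eraseVar_zero_eq]
  exact Polynomial.aeval_mem_adjoin_singleton _ _

theorem exists_of_mem_explicitW {ξ₁ ξ₂ β : ℂ} {f : Poly} (hf : f ∈ explicitW ξ₁ ξ₂ β) :
    ∃ (c : ℂ) (p q h : Poly), eraseVar 1 p = p ∧ eraseVar 0 q = q ∧
      f = C c * genW ξ₁ ξ₂ β + (C ξ₂ + C (ξ₂ ^ 2) * X 1 + C β * X 0) * X 0 ^ 2 * p +
        (C ξ₁ + C (ξ₁ ^ 2) * X 0 + C β * X 1) * X 1 ^ 2 * q + X 0 ^ 2 * X 1 ^ 2 * h := by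
  simp only [explicitW, Submodule.mem_sup, Submodule.mem_span_singleton, Submodule.mem_map,
    LinearMap.mem_range] at hf
  obtain ⟨_, ⟨_, ⟨_, ⟨c, rfl⟩, _, ⟨p, hp, rfl⟩, rfl⟩, _, ⟨q, hq, rfl⟩, rfl⟩, _, ⟨h, rfl⟩, rfl⟩ := hf
  exact ⟨c, p, q, h, eraseVar_of_mem_adjoin (by decide) hp, eraseVar_of_mem_adjoin (by decide) hq,
    by simp only [LinearMap.mulLeft_apply, smul_eq_C_mul]; rfl⟩

theorem mem_explicitW (ξ₁ ξ₂ β c : ℂ) (p q h : Poly) :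
    C c * genW ξ₁ ξ₂ β + (C ξ₂ + C (ξ₂ ^ 2) * X 1 + C β * X 0) * X 0 ^ 2 * eraseVar 1 p +
        (C ξ₁ + C (ξ₁ ^ 2) * X 0 + C β * X 1) * X 1 ^ 2 * eraseVar 0 q + X 0 ^ 2 * X 1 ^ 2 * h ∈
      explicitW ξ₁ ξ₂ β := by
  rw [← smul_eq_C_mul]
  exact Submodule.add_mem_sup (Submodule.add_mem_sup (Submodule.add_mem_sup
    (Submodule.smul_mem _ _ (Submodule.mem_span_singleton_self _))
    ⟨_, eraseVar_one_mem_adjoin p, rfl⟩) ⟨_, eraseVar_zero_mem_adjoin q, rfl⟩) ⟨h, rfl⟩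

theorem act_inv_shift {ξ : ℂ} (hξ : ξ ≠ 0) (i : Fin 2) (f : Poly) :
    act (shift i ξ) (act (shift i ξ)⁻¹ f) = f := by
  rw [← act_mul, shift_mul_inv i hξ, act_one]

theorem act_shift_injective {ξ : ℂ} (hξ : ξ ≠ 0) (i : Fin 2) :
    Function.Injective (act (shift i ξ)) := by
  refine Function.LeftInverse.injective (g := act (shift i ξ)⁻¹) fun f => ?_
  rw [← act_mul, mul_comm, shift_mul_inv i hξ, act_one]

/-- Setting zⱼ = 0 commutes with ξ - ∂/∂zᵢ, hence with its inverse. -/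
theorem eraseVar_act_inv_shift {ξ : ℂ} (hξ : ξ ≠ 0) {i j : Fin 2} (h : i ≠ j) {f : Poly}
    (hf : eraseVar j f = f) : eraseVar j (act (shift i ξ)⁻¹ f) = act (shift i ξ)⁻¹ f := by
  apply act_shift_injective hξ i
  have e := act_inv_shift hξ i f
  rw [act_shift] at e
  have e' := congrArg (eraseVar j) e
  rw [hf, map_sub, map_mul, eraseVar_C] at e'
  rw [act_shift, act_shift, pderiv_eraseVar_of_ne h, e', e]

theorem genW_eq {ξ₁ ξ₂ β : ℂ} (h₁ : ξ₁ ≠ 0) (h₂ : ξ₂ ≠ 0) (hβ : ξ₁ * ξ₂ - β ≠ 0) :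
    genW ξ₁ ξ₂ β = rightAct (act (shift 0 ξ₁ * shift 1 ξ₂)
      (C ((ξ₁ * ξ₂ - β) / (ξ₁ * ξ₂)))) (opS ξ₁ ξ₂ β) := by
  rw [rightAct_opS h₁ h₂, act_mul]
  simp only [act_shift, map_sub, map_mul, pderiv_mul, pderiv_C, eraseVar_C, sub_zero, mul_zero,
    zero_mul, add_zero, genW]
  have hβ' : ξ₂ * ξ₁ - β ≠ 0 := by rwa [mul_comm]
  -- For constant g = k the coefficient of z₁z₂ in the image is ξ₁ξ₂k; comparison with w dictates k.
  -- The identities below compare the coefficients of the six monomials of w.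
  generalize hk : (ξ₁ * ξ₂ - β) / (ξ₁ * ξ₂) = k
  have c00 : (1 : ℂ) = k + β * (1 / (ξ₁ * ξ₂ - β)) * k := by
    subst hk; field_simp; ring
  have c10 : ξ₁ = ξ₁ * k + β * (1 / ξ₂) * k + β * (1 / (ξ₁ * ξ₂ - β)) * k * β * (1 / ξ₂) := by
    subst hk; field_simp; ring
  have c01 : ξ₂ = ξ₂ * k + β * (1 / ξ₁) * k + β * (1 / (ξ₁ * ξ₂ - β)) * k * β * (1 / ξ₁) := by
    subst hk; field_simp; ring
  have c11 : ξ₁ * ξ₂ - β = ξ₁ * ξ₂ * k := by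
    subst hk; field_simp
  have c20 : (ξ₁ * ξ₂ - β) * β * (1 / ξ₂ ^ 2) = β * (1 / ξ₂) * ξ₁ * k := by
    subst hk; field_simp
  have c02 : (ξ₁ * ξ₂ - β) * β * (1 / ξ₁ ^ 2) = β * (1 / ξ₁) * ξ₂ * k := by
    subst hk; field_simp
  replace c00 := congrArg (C : ℂ → Poly) c00
  replace c10 := congrArg (C : ℂ → Poly) c10
  replace c01 := congrArg (C : ℂ → Poly) c01
  replace c11 := congrArg (C : ℂ → Poly) c11
  replace c20 := congrArg (C : ℂ → Poly) c20
  replace c02 := congrArg (C : ℂ → Poly) c02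
  simp only [map_add, map_mul, map_sub, map_one] at c00 c10 c01 c11 c20 c02
  linear_combination c00 + X 0 * c10 + X 1 * c01 + X 0 * X 1 * c11 + X 0 ^ 2 * c20 + X 1 ^ 2 * c02

theorem genW_mem {ξ₁ ξ₂ β : ℂ} (h₁ : ξ₁ ≠ 0) (h₂ : ξ₂ ≠ 0) (hβ : ξ₁ * ξ₂ - β ≠ 0) :
    genW ξ₁ ξ₂ β ∈ moduleW ξ₁ ξ₂ β := by
  rw [genW_eq h₁ h₂ hβ]
  exact rightAct_opS_mem h₁ h₂ hβ _

theorem explicitW_le_range {ξ₁ ξ₂ β : ℂ} (h₁ : ξ₁ ≠ 0) (h₂ : ξ₂ ≠ 0) (hβ : ξ₁ * ξ₂ - β ≠ 0) :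
    explicitW ξ₁ ξ₂ β ≤ LinearMap.range (rightActₗ (opS ξ₁ ξ₂ β)) := by
  intro f hf
  obtain ⟨c, p, q, h, hp, hq, rfl⟩ := exists_of_mem_explicitW hf
  have e1 := C_mul_C_one_div h₁
  have e2 := C_mul_C_one_div h₂
  refine add_mem (add_mem (add_mem ?_ ?_) ?_) ?_
  · rw [← smul_eq_C_mul, genW_eq h₁ h₂ hβ]
    exact Submodule.smul_mem _ _ ⟨_, rfl⟩
  · have hr := eraseVar_act_inv_shift h₁ (i := 0) (j := 1) (by decide) hp
    have hd := act_inv_shift h₁ 0 p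
    generalize act (shift 0 ξ₁)⁻¹ p = r at hr hd
    rw [act_shift] at hd
    have hr' : pderiv 1 r = 0 := by rw [← hr, pderiv_eraseVar_self]
    -- With g = ξ₂ z₁ r and r = r(z₁), both g(0, z₂) and g(0,0) vanish, so only the β-terms on the
    -- line z₂ = 0 remain.
    refine ⟨act (shift 0 ξ₁ * shift 1 ξ₂) (C ξ₂ * (X 0 * r)), ?_⟩
    rw [rightActₗ_apply, rightAct_opS h₁ h₂, act_mul]
    simp only [act_shift, map_add, map_sub, map_mul, map_pow, pderiv_mul, pderiv_C, pderiv_X_self,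
      pderiv_one_X_zero, eraseVar_C, eraseVar_X_self, eraseVar_one_X_zero, hr, hr', map_zero,
      ← pderiv_zero_eraseVar_one, zero_mul, mul_zero, zero_add, add_zero,
      map_one]
    rw [← hd]
    linear_combination (C β * X 0 ^ 3 * (C ξ₁ * r - pderiv 0 r)) * e2
  · have hr := eraseVar_act_inv_shift h₂ (i := 1) (j := 0) (by decide) hq
    have hd := act_inv_shift h₂ 1 q
    generalize act (shift 1 ξ₂)⁻¹ q = r at hr hd
    rw [act_shift] at hd
    have hr' : pderiv 0 r = 0 := by rw [← hr, pderiv_eraseVar_self]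
    refine ⟨act (shift 0 ξ₁ * shift 1 ξ₂) (C ξ₁ * (X 1 * r)), ?_⟩
    rw [rightActₗ_apply, rightAct_opS h₁ h₂, mul_comm (shift 0 ξ₁), act_mul]
    simp only [act_shift, map_add, map_sub, map_mul, map_pow, pderiv_mul, pderiv_C, pderiv_X_self,
      pderiv_zero_X_one, eraseVar_C, eraseVar_X_self, eraseVar_zero_X_one, hr, hr', map_zero,
      ← pderiv_one_eraseVar_zero, zero_mul, mul_zero, zero_add, add_zero, map_one]
    rw [← hd]
    linear_combination (C β * X 1 ^ 3 * (C ξ₂ * r - pderiv 1 r)) * e1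
  · have hd := act_inv_shift h₁ 0 h
    rw [← act_inv_shift h₂ 1 (act (shift 0 ξ₁)⁻¹ h)] at hd
    generalize act (shift 1 ξ₂)⁻¹ (act (shift 0 ξ₁)⁻¹ h) = r at hd
    -- The factor z₁z₂ makes all β-terms vanish.
    refine ⟨act (shift 0 ξ₁ * shift 1 ξ₂) (X 0 * (X 1 * r)), ?_⟩
    rw [rightActₗ_apply, rightAct_opS h₁ h₂, act_mul]
    simp only [act_shift] at hd
    simp only [act_shift, map_add, map_sub, map_mul, pderiv_mul, pderiv_C, pderiv_X_self,
      pderiv_zero_X_one, pderiv_one_X_zero, pderiv_one, eraseVar_C, eraseVar_X_self, eraseVar_zero_X_one,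
      eraseVar_one_X_zero, map_zero, zero_mul, mul_zero, zero_add, add_zero, map_one] at hd ⊢
    rw [← hd]
    ring

theorem X_zero_sq_mul_X_one_sq_dvd {f : Poly} (h₁ : eraseVar 1 f = 0)
    (h₁' : eraseVar 1 (pderiv 1 f) = 0) (h₀ : eraseVar 0 f = 0)
    (h₀' : eraseVar 0 (pderiv 0 f) = 0) : ∃ h, f = X 0 ^ 2 * X 1 ^ 2 * h := by
  obtain ⟨r, rfl⟩ := X_sq_dvd h₁ h₁'
  have hX : (X 1 ^ 2 : Poly) ≠ 0 := pow_ne_zero _ (X_ne_zero _)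
  simp only [map_mul, map_pow, eraseVar_zero_X_one, pderiv_mul, pderiv_pow, pderiv_zero_X_one,
    mul_zero, zero_mul, zero_add] at h₀ h₀'
  obtain ⟨h, rfl⟩ := X_sq_dvd ((mul_eq_zero.mp h₀).resolve_left hX)
    ((mul_eq_zero.mp h₀').resolve_left hX)
  exact ⟨h, by ring⟩

theorem eraseVar_zero_eraseVar_one (f : Poly) :
    eraseVar 0 (eraseVar 1 f) = C (constantCoeff f) := by
  induction f using MvPolynomial.induction_on with
  | C a => simp
  | add p q hp hq => simp [hp, hq]
  | mul_X p i h => fin_cases i <;> simp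

theorem sub_C_mul_mem_moduleW {ξ₁ ξ₂ β : ℂ} (h₁ : ξ₁ ≠ 0) (h₂ : ξ₂ ≠ 0) {f g : Poly}
    (hf : f ∈ moduleW ξ₁ ξ₂ β) (hg : g ∈ moduleW ξ₁ ξ₂ β) (c : ℂ) :
    f - C c * g ∈ moduleW ξ₁ ξ₂ β := by
  rw [mem_moduleW h₁ h₂] at hf hg ⊢
  simp only [map_sub, map_mul, eraseVar_C, pderiv_C_mul]
  constructor
  · linear_combination hf.1 - C c * hg.1
  · linear_combination hf.2 - C c * hg.2

/-- If `f ∈ W_β` has no constant term, then the normal derivatives of `f` on the two coordinate lines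
vanish to second order at the origin. -/
theorem exists_eq_X_sq_mul {ξ₁ ξ₂ β : ℂ} (h₁ : ξ₁ ≠ 0) (h₂ : ξ₂ ≠ 0) {f' : Poly}
    (hf : f' ∈ moduleW ξ₁ ξ₂ β) (h00 : eraseVar 0 (eraseVar 1 f') = 0) :
    ∃ p q : Poly, eraseVar 1 (pderiv 1 f') = X 0 ^ 2 * eraseVar 1 p ∧
      eraseVar 0 (pderiv 0 f') = X 1 ^ 2 * eraseVar 0 q := by
  have hc1 : (C ξ₁ : Poly) ≠ 0 := by simpa using h₁
  have hc2 : (C ξ₂ : Poly) ≠ 0 := by simpa using h₂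
  rw [mem_moduleW h₁ h₂] at hf
  obtain ⟨m1, m0⟩ := hf
  have z1 : eraseVar 0 (eraseVar 1 (pderiv 1 f')) = 0 := by
    have := congrArg (eraseVar 0) m1
    simp only [map_mul, map_add, eraseVar_C, eraseVar_X_self, h00, mul_zero, add_zero] at this
    exact (mul_eq_zero.mp this).resolve_left hc2
  have z0 : eraseVar 0 (eraseVar 1 (pderiv 0 f')) = 0 := by
    have := congrArg (eraseVar 1) m0
    simp only [map_mul, map_add, eraseVar_C, eraseVar_X_self, eraseVar_comm, h00, mul_zero,
      add_zero] at this
    exact (mul_eq_zero.mp this).resolve_left hc1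
  -- Differentiating the line condition along the line at the origin leaves ξ₂ ∂₁∂₂f' = 0, since
  -- both first derivatives vanish there.
  have z1' : eraseVar 0 (pderiv 0 (eraseVar 1 (pderiv 1 f'))) = 0 := by
    have := congrArg (fun f => eraseVar 0 (pderiv 0 f)) m1
    simp only [map_mul, map_add, eraseVar_C, eraseVar_X_self, mul_zero, add_zero, pderiv_mul,
      pderiv_C, pderiv_X_self, pderiv_zero_eraseVar_one, z0, z1, zero_mul, zero_add] at this
    rw [pderiv_zero_eraseVar_one]
    exact (mul_eq_zero.mp this).resolve_left hc2
  have z0' : eraseVar 1 (pderiv 1 (eraseVar 0 (pderiv 0 f'))) = 0 := by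
    have := congrArg (fun f => eraseVar 1 (pderiv 1 f)) m0
    simp only [map_mul, map_add, eraseVar_C, eraseVar_X_self, eraseVar_comm, mul_zero,
      add_zero, pderiv_mul, pderiv_C, pderiv_X_self, pderiv_one_eraseVar_zero, z0, z1, zero_mul, zero_add] at this
    rw [pderiv_one_eraseVar_zero, eraseVar_comm]
    exact (mul_eq_zero.mp this).resolve_left hc1
  obtain ⟨p, hp⟩ := X_sq_dvd z1 z1'
  obtain ⟨q, hq⟩ := X_sq_dvd ((eraseVar_comm (pderiv 0 f')).trans z0) z0'
  refine ⟨p, q, ?_, ?_⟩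
  · rw [← eraseVar_eraseVar, hp, map_mul, map_pow, eraseVar_one_X_zero]
  · rw [← eraseVar_eraseVar, hq, map_mul, map_pow, eraseVar_zero_X_one]

theorem moduleW_le_explicitW {ξ₁ ξ₂ β : ℂ} (h₁ : ξ₁ ≠ 0) (h₂ : ξ₂ ≠ 0) (hβ : ξ₁ * ξ₂ - β ≠ 0)
    {f : Poly} (hf : f ∈ moduleW ξ₁ ξ₂ β) : f ∈ explicitW ξ₁ ξ₂ β := by
  have hW := sub_C_mul_mem_moduleW h₁ h₂ hf (genW_mem h₁ h₂ hβ) (constantCoeff f)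
  have h00 : eraseVar 0 (eraseVar 1 (f - C (constantCoeff f) * genW ξ₁ ξ₂ β)) = 0 := by
    rw [eraseVar_zero_eraseVar_one]
    simp [genW]
  have hf' : f = C (constantCoeff f) * genW ξ₁ ξ₂ β +
      (f - C (constantCoeff f) * genW ξ₁ ξ₂ β) := by ring
  generalize f - C (constantCoeff f) * genW ξ₁ ξ₂ β = f' at hW h00 hf'
  obtain ⟨p, q, hp, hq⟩ := exists_eq_X_sq_mul h₁ h₂ hW h00
  rw [mem_moduleW h₁ h₂] at hW
  have e1 := C_mul_C_one_div (pow_ne_zero 2 h₁)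
  have e2 := C_mul_C_one_div (pow_ne_zero 2 h₂)
  rw [hp, hq] at hW
  -- Each correction vanishes to second order along the other line, so the two do not interfere. The
  -- factors ξ₂⁻² and ξ₁⁻² match the normal derivatives of the generators.
  obtain ⟨h, hh⟩ := X_zero_sq_mul_X_one_sq_dvd
    (f := f' - (C ξ₂ + C (ξ₂ ^ 2) * X 1 + C β * X 0) * X 0 ^ 2 * eraseVar 1 (C (1 / ξ₂ ^ 2) * p) -
      (C ξ₁ + C (ξ₁ ^ 2) * X 0 + C β * X 1) * X 1 ^ 2 * eraseVar 0 (C (1 / ξ₁ ^ 2) * q)) (by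
      simp only [map_mul, map_add, map_sub, map_pow, eraseVar_C, eraseVar_X_self,
        eraseVar_one_X_zero, eraseVar_eraseVar]
      simp only [C_pow] at hW e2
      linear_combination (-eraseVar 1 f') * e2 - C (1 / ξ₂ ^ 2) * hW.1) (by
      simp only [map_mul, map_add, map_sub, map_pow, eraseVar_C, eraseVar_X_self,
        eraseVar_one_X_zero, eraseVar_eraseVar, pderiv_mul, pderiv_C, pderiv_X_self, pderiv_pow,
        pderiv_one_X_zero, hp, map_zero, map_one, pderiv_eraseVar_self, eraseVar_comm,
        pderiv_one_eraseVar_zero]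
      rw [C_pow] at e2
      linear_combination (-X 0 ^ 2 * eraseVar 1 p) * e2) (by
      simp only [map_mul, map_add, map_sub, map_pow, eraseVar_C, eraseVar_X_self,
        eraseVar_zero_X_one, eraseVar_eraseVar]
      simp only [C_pow] at hW e1
      linear_combination (-eraseVar 0 f') * e1 - C (1 / ξ₁ ^ 2) * hW.2) (by
      simp only [map_mul, map_add, map_sub, map_pow, eraseVar_C, eraseVar_X_self,
        eraseVar_zero_X_one, eraseVar_eraseVar, pderiv_mul, pderiv_C, pderiv_X_self, pderiv_pow,
        pderiv_zero_X_one, hq, map_zero, map_one, pderiv_eraseVar_self,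
        pderiv_zero_eraseVar_one]
      rw [C_pow] at e1
      linear_combination (-X 1 ^ 2 * eraseVar 0 q) * e1)
  have := mem_explicitW ξ₁ ξ₂ β (constantCoeff f) (C (1 / ξ₂ ^ 2) * p) (C (1 / ξ₁ ^ 2) * q) h
  rw [← hh] at this
  convert this using 1
  linear_combination hf'

theorem range_le_moduleW {ξ₁ ξ₂ β : ℂ} (h₁ : ξ₁ ≠ 0) (h₂ : ξ₂ ≠ 0) (hβ : ξ₁ * ξ₂ - β ≠ 0)
    (f : Poly) : rightAct f (opS ξ₁ ξ₂ β) ∈ moduleW ξ₁ ξ₂ β := by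
  have e : f = act (shift 0 ξ₁ * shift 1 ξ₂) (act (shift 1 ξ₂)⁻¹ (act (shift 0 ξ₁)⁻¹ f)) := by
    rw [act_mul, act_inv_shift h₂, act_inv_shift h₁]
  rw [e]
  exact rightAct_opS_mem h₁ h₂ hβ _

theorem moduleW_eq_explicitW {ξ₁ ξ₂ β : ℂ} (h₁ : ξ₁ ≠ 0) (h₂ : ξ₂ ≠ 0) (hβ : ξ₁ * ξ₂ - β ≠ 0) :
    (moduleW ξ₁ ξ₂ β).restrictScalars ℂ = explicitW ξ₁ ξ₂ β := by
  refine le_antisymm (fun f hf => moduleW_le_explicitW h₁ h₂ hβ hf) fun f hf => ?_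
  obtain ⟨g, rfl⟩ := explicitW_le_range h₁ h₂ hβ hf
  exact range_le_moduleW h₁ h₂ hβ g

theorem coe_moduleW_eq_range {ξ₁ ξ₂ β : ℂ} (h₁ : ξ₁ ≠ 0) (h₂ : ξ₂ ≠ 0) (hβ : ξ₁ * ξ₂ - β ≠ 0) :
    (((moduleW ξ₁ ξ₂ β).restrictScalars ℂ : Submodule ℂ Poly) : Set Poly) =
      Set.range fun f : Poly => rightAct f (opS ξ₁ ξ₂ β) := by
  refine Set.Subset.antisymm (fun f hf => ?_) ?_
  · exact explicitW_le_range h₁ h₂ hβ (moduleW_le_explicitW h₁ h₂ hβ hf)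
  · rintro _ ⟨f, rfl⟩
    exact range_le_moduleW h₁ h₂ hβ f

/-! ### Orders and symbols -/

/-- All terms of `P` have order at most `d`, and those of order `d` add up to `H`. -/
structure HasTop (P : Op) (d : ℤ) (H : Op) : Prop where
  le : ∀ k s : Expo, MvPowerSeries.coeff s (P.1 k) ≠ 0 → (k.degree : ℤ) - s.degree ≤ d
  top : component P (-d) = H

/-- All terms of `P` have order `d`. -/
def IsHomogeneousOp (P : Op) (d : ℤ) : Prop :=
  ∀ k s : Expo, MvPowerSeries.coeff s (P.1 k) ≠ 0 → (k.degree : ℤ) - s.degree = d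

theorem coeff_component (P : Op) (m : ℤ) (k s : Expo) :
    MvPowerSeries.coeff s ((component P m).1 k) =
      if (s.degree : ℤ) - (k.degree : ℤ) = m then MvPowerSeries.coeff s (P.1 k) else 0 := rfl

theorem Op.ext_coeff {P Q : Op}
    (h : ∀ k s : Expo, MvPowerSeries.coeff s (P.1 k) = MvPowerSeries.coeff s (Q.1 k)) : P = Q :=
  Subtype.ext (funext fun k => MvPowerSeries.ext fun s => h k s)

theorem coeff_op_add (P Q : Op) (k s : Expo) : MvPowerSeries.coeff s ((P + Q).1 k) =
    MvPowerSeries.coeff s (P.1 k) + MvPowerSeries.coeff s (Q.1 k) := rfl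

theorem coeff_op_smul (c : ℂ) (P : Op) (k s : Expo) : MvPowerSeries.coeff s ((c • P).1 k) =
    c * MvPowerSeries.coeff s (P.1 k) := rfl

theorem coeff_op_zero (k s : Expo) : MvPowerSeries.coeff s ((0 : Op).1 k) = 0 := rfl

theorem component_add (P Q : Op) (m : ℤ) : component (P + Q) m = component P m + component Q m := by
  refine Op.ext_coeff fun k s => ?_
  simp only [coeff_component, coeff_op_add]
  split_ifs <;> simp

theorem component_smul (c : ℂ) (P : Op) (m : ℤ) : component (c • P) m = c • component P m := by
  refine Op.ext_coeff fun k s => ?_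
  simp only [coeff_component, coeff_op_smul]
  split_ifs <;> simp

theorem HasTop.add {P Q H K : Op} {d : ℤ} (hP : HasTop P d H) (hQ : HasTop Q d K) :
    HasTop (P + Q) d (H + K) where
  le k s h := by
    by_cases h' : MvPowerSeries.coeff s (P.1 k) = 0
    · refine hQ.le k s fun h'' => h ?_
      rw [coeff_op_add, h', h'', add_zero]
    · exact hP.le k s h'
  top := by rw [component_add, hP.top, hQ.top]

theorem HasTop.smul {P H : Op} {d : ℤ} (hP : HasTop P d H) (c : ℂ) : HasTop (c • P) d (c • H) where
  le k s h := hP.le k s fun h' => h (by rw [coeff_op_smul, h', mul_zero])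
  top := by rw [component_smul, hP.top]

theorem IsHomogeneousOp.hasTop {P : Op} {d : ℤ} (hP : IsHomogeneousOp P d) : HasTop P d P where
  le k s h := (hP k s h).le
  top := by
    refine Op.ext_coeff fun k s => ?_
    rw [coeff_component]
    split_ifs with h
    · rfl
    · by_contra h'
      exact h (by have := hP k s (Ne.symm h'); omega)

theorem hasTop_zero_of_lt {P : Op} {d e : ℤ}
    (hP : ∀ k s : Expo, MvPowerSeries.coeff s (P.1 k) ≠ 0 → (k.degree : ℤ) - s.degree ≤ d)
    (h : d < e) : HasTop P e 0 where
  le k s h' := (hP k s h').trans h.le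
  top := by
    refine Op.ext_coeff fun k s => ?_
    rw [coeff_component, coeff_op_zero]
    split_ifs with h1
    · by_contra h'
      have := hP k s h'
      omega
    · rfl

/-- A positive power of x lowers the order, so only the constant term of `a` reaches the top
component. -/
theorem HasTop.fn_mul {P H : Op} {d : ℤ} (hP : HasTop P d H) (a : PS) :
    HasTop (fn a * P) d (MvPowerSeries.constantCoeff a • H) where
  le k s h := by
    rw [fn_mul_apply, MvPowerSeries.coeff_mul] at h
    obtain ⟨q, hq, h4⟩ := Finset.exists_ne_zero_of_sum_ne_zero h
    have := hP.le k q.2 (right_ne_zero_of_mul h4)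
    rw [mem_antidiagonal] at hq
    rw [← hq, map_add]
    push_cast
    linarith [(Nat.cast_nonneg q.1.degree : (0 : ℤ) ≤ _)]
  top := by
    rw [← hP.top]
    refine Op.ext_coeff fun k s => ?_
    rw [coeff_op_smul, coeff_component, coeff_component]
    split_ifs with h
    · rw [fn_mul_apply, MvPowerSeries.coeff_mul, Finset.sum_eq_single (0, s)]
      · simp
      · rintro ⟨u, t⟩ hut hne
        rw [mem_antidiagonal] at hut
        by_contra h'
        have := hP.le k t (right_ne_zero_of_mul h')
        have hs : (s.degree : ℤ) = u.degree + t.degree := by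
          rw [← hut, map_add]; push_cast; rfl
        have hu : u.degree = 0 := by omega
        rw [Finsupp.degree_eq_zero_iff] at hu
        subst hu
        simp only [zero_add] at hut
        exact hne (by rw [hut])
      · simp
    · simp

theorem exists_apply_ne_zero_of_finsum_ne_zero {g : Expo → ℂ} (h : ∑ᶠ i, g i ≠ 0) : ∃ i, g i ≠ 0 := by
  by_contra! h'
  exact h ((finsum_congr h').trans finsum_zero)

/-- In a Leibniz term, i is removed both from the ∂-exponent of `P` and from the x-exponent of `Q`,
so orders add. -/
theorem exists_coeff_ne_zero_of_mul {P Q : Op} {k s : Expo}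
    (h : MvPowerSeries.coeff s ((P * Q).1 k) ≠ 0) :
    ∃ k₁ s₁ k₂ s₂ : Expo, MvPowerSeries.coeff s₁ (P.1 k₁) ≠ 0 ∧
      MvPowerSeries.coeff s₂ (Q.1 k₂) ≠ 0 ∧ (k.degree : ℤ) - s.degree =
        ((k₁.degree : ℤ) - s₁.degree) + ((k₂.degree : ℤ) - s₂.degree) := by
  obtain ⟨p, hp, h1⟩ := Finset.exists_ne_zero_of_sum_ne_zero
    (show ∑ p ∈ antidiagonal k, ∑ᶠ i : Expo,
      (((p.1 + i) 0).choose (i 0) * ((p.1 + i) 1).choose (i 1) : ℂ) *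
      MvPowerSeries.coeff s (P.1 (p.1 + i) * iterD i (Q.1 p.2)) ≠ 0 from h)
  obtain ⟨i, h2⟩ := exists_apply_ne_zero_of_finsum_ne_zero h1
  have h3 := right_ne_zero_of_mul h2
  rw [MvPowerSeries.coeff_mul] at h3
  obtain ⟨q, hq, h4⟩ := Finset.exists_ne_zero_of_sum_ne_zero h3
  refine ⟨_, _, _, _, left_ne_zero_of_mul h4, coeff_iterD_ne _ _ _ (right_ne_zero_of_mul h4), ?_⟩
  rw [mem_antidiagonal] at hp hq
  rw [← hp, ← hq]
  simp only [map_add, Nat.cast_add]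
  ring

theorem IsHomogeneousOp.mul {P Q : Op} {d e : ℤ} (hP : IsHomogeneousOp P d)
    (hQ : IsHomogeneousOp Q e) : IsHomogeneousOp (P * Q) (d + e) := by
  intro k s h
  obtain ⟨k₁, s₁, k₂, s₂, h₁, h₂, h₃⟩ := exists_coeff_ne_zero_of_mul h
  rw [h₃, hP _ _ h₁, hQ _ _ h₂]

theorem isHomogeneousOp_pd (i : Fin 2) : IsHomogeneousOp (pd i) 1 := by
  intro k s h
  change MvPowerSeries.coeff s (MvPowerSeries.C (coeff k (X i : Poly))) ≠ 0 at h
  rw [MvPowerSeries.coeff_C, coeff_X] at h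
  split_ifs at h with h1 h2
  · subst h1 h2
    simp
  · simp at h
  · simp at h

theorem isHomogeneousOp_E (i : Fin 2) : IsHomogeneousOp (E i) 0 := by
  intro k s h
  rw [E_apply, MvPowerSeries.coeff_monomial] at h
  split_ifs at h with h1
  · rw [h1, sub_self]
  · simp at h
  · simp at h

theorem isHomogeneousOp_one : IsHomogeneousOp 1 0 := by
  intro k s h
  change MvPowerSeries.coeff s (if k = 0 then (1 : PS) else 0) ≠ 0 at h
  split_ifs at h with h1
  · rw [MvPowerSeries.coeff_one] at h
    split_ifs at h with h2
    · simp [h1, h2]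
    · simp at h
  · simp at h

/-- Allowing a zero top component lets summands of lower order be added on the same footing. -/
theorem HasTop.of_lt {P H : Op} {d e : ℤ} (h : HasTop P d H) (hde : d < e) : HasTop P e 0 :=
  hasTop_zero_of_lt h.le hde

theorem HasTop.mul_le {P Q H K : Op} {d e : ℤ} (hP : HasTop P d H) (hQ : HasTop Q e K)
    (k s : Expo) (h : MvPowerSeries.coeff s ((P * Q).1 k) ≠ 0) :
    (k.degree : ℤ) - s.degree ≤ d + e := by
  obtain ⟨k₁, s₁, k₂, s₂, h₁, h₂, h₃⟩ := exists_coeff_ne_zero_of_mul h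
  rw [h₃]
  exact add_le_add (hP.le _ _ h₁) (hQ.le _ _ h₂)

theorem HasTop.hasOrder {P H : Op} {d : ℤ} (h : HasTop P d H) (hH : H ≠ 0) : HasOrder P.1 d := by
  refine ⟨?_, fun e he => ?_⟩
  · rintro _ ⟨k, s, h', rfl⟩
    exact h.le k s h'
  · by_contra hlt
    refine hH (h.top.symm.trans (hasTop_zero_of_lt (fun k s h' => ?_) (not_le.mp hlt)).top)
    exact he ⟨k, s, h', rfl⟩

theorem constantCoeff_inv_shift (i : Fin 2) (ξ : ℂ) :
    MvPowerSeries.constantCoeff (shift i ξ)⁻¹ = 1 / ξ := by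
  simp [shift]

theorem constantCoeff_shift (i : Fin 2) (ξ : ℂ) :
    MvPowerSeries.constantCoeff (shift i ξ) = ξ := by
  simp [shift]

/-- The symbol of `S_β` acts as `∂₁∂₂ + β (ξ₂⁻² E₂ ∂₁² + ξ₁⁻² E₁ ∂₂²)`. -/
theorem exists_hasTop_opS {ξ₁ ξ₂ : ℂ} (h₁ : ξ₁ ≠ 0) (h₂ : ξ₂ ≠ 0) (β : ℂ) :
    ∃ H, HasTop (opS ξ₁ ξ₂ β) 2 H ∧ ∀ f, rightAct f H = X 0 * X 1 * f +
      C β * (C (1 / ξ₂ ^ 2) * X 0 ^ 2 * eraseVar 1 f + C (1 / ξ₁ ^ 2) * X 1 ^ 2 * eraseVar 0 f) := by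
  have hone : HasTop 1 1 0 := isHomogeneousOp_one.hasTop.of_lt (by norm_num)
  have hpd (i) : HasTop (pd i) 2 0 := (isHomogeneousOp_pd i).hasTop.of_lt (by norm_num)
  have hfn (a : PS) : HasTop (fn a) 2 0 := by
    have : fn a = fn a * 1 := Subtype.ext (funext fun k => by
      rw [fn_mul_apply]
      change (if k = 0 then a else 0) = a * (if k = 0 then (1 : PS) else 0)
      split_ifs <;> simp)
    rw [this]
    simpa using (hone.of_lt (show (1 : ℤ) < 2 by norm_num)).fn_mul a
  have h0 := ((isHomogeneousOp_pd 0).mul (isHomogeneousOp_pd 1)).hasTop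
  have hE1 := ((isHomogeneousOp_E 1).mul (isHomogeneousOp_pd 0)).hasTop.of_lt
    (show (0 + 1 : ℤ) < 2 by norm_num)
  have hE0 := ((isHomogeneousOp_E 0).mul (isHomogeneousOp_pd 1)).hasTop.of_lt
    (show (0 + 1 : ℤ) < 2 by norm_num)
  -- Only this operator and the next one give order 2 in T.
  have hE1' := ((isHomogeneousOp_E 1).mul
    ((isHomogeneousOp_pd 0).mul (isHomogeneousOp_pd 0))).hasTop
  have hE0' := ((isHomogeneousOp_E 0).mul
    ((isHomogeneousOp_pd 1).mul (isHomogeneousOp_pd 1))).hasTop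
  have hEE : HasTop ((E 0 * E 1) * (1 + β • ((1 / ξ₂) • pd 0 + (1 / ξ₁) • pd 1))) 2 0 :=
    hasTop_zero_of_lt (((isHomogeneousOp_E 0).mul (isHomogeneousOp_E 1)).hasTop.mul_le
      (hone.add ((((isHomogeneousOp_pd 0).hasTop.smul _).add
        ((isHomogeneousOp_pd 1).hasTop.smul _)).smul β))) (by norm_num)
  refine ⟨_, (((h0.add ((hpd 0).fn_mul _)).add ((hpd 1).fn_mul _)).add (hfn _)).add
    (((((hE1.add (hE1'.fn_mul _)).smul _).add ((hE0.add (hE0'.fn_mul _)).smul _)).fn_mul _ |>.add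
      ((hEE.fn_mul _).smul _)).smul _), fun f => ?_⟩
  simp only [rightAct_op_add, rightAct_op_smul, pd, ofPoly_mul, rightAct_ofPoly,
    rightAct_mul_ofPoly, rightAct_E, smul_zero, add_zero, zero_add, map_mul,
    constantCoeff_inv_shift, constantCoeff_shift, smul_eq_C_mul]
  have c1 : 1 / ξ₁ * (1 / ξ₂) * (1 / ξ₂) * ξ₁ = 1 / ξ₂ ^ 2 := by field_simp
  have c2 : 1 / ξ₁ * (1 / ξ₂) * (1 / ξ₁) * ξ₂ = 1 / ξ₁ ^ 2 := by field_simp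
  rw [← c1, ← c2]
  simp only [C_mul]
  ring

theorem isSatoOperator_opS {ξ₁ ξ₂ β : ℂ} (h₁ : ξ₁ ≠ 0) (h₂ : ξ₂ ≠ 0) (hβ : ξ₁ * ξ₂ - β ≠ 0) :
    IsSatoOperator 2 ((moduleW ξ₁ ξ₂ β).restrictScalars ℂ) (opS ξ₁ ξ₂ β) := by
  obtain ⟨H, hH, hact⟩ := exists_hasTop_opS h₁ h₂ β
  have hinj : Function.Injective fun f : Poly => rightAct f H := by
    change Function.Injective (rightActₗ H)
    rw [injective_iff_map_eq_zero]
    intro f hf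
    rw [rightActₗ_apply, hact] at hf
    have hX : (X 0 * X 1 : Poly) ≠ 0 := mul_ne_zero (X_ne_zero _) (X_ne_zero _)
    have hc1 : (C (1 / ξ₁ ^ 2) : Poly) ≠ 0 := by simpa using h₁
    have hc2 : (C (1 / ξ₂ ^ 2) : Poly) ≠ 0 := by simpa using h₂
    have k1 := congrArg (eraseVar 1) hf
    have k0 := congrArg (eraseVar 0) hf
    simp only [map_add, map_mul, map_pow, eraseVar_C, eraseVar_X_self, eraseVar_one_X_zero,
      eraseVar_zero_X_one, eraseVar_eraseVar, map_zero, ne_eq, OfNat.ofNat_ne_zero,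
      not_false_eq_true, zero_pow, mul_zero, zero_mul, add_zero, zero_add] at k0 k1
    -- On z₂ = 0 only the term with z₁² f(z₁,0) survives. Keeping the factor β covers β = 0 as well.
    have l1 : C β * eraseVar 1 f = 0 := by
      have : (C (1 / ξ₂ ^ 2) * X 0 ^ 2) * (C β * eraseVar 1 f) = 0 := by linear_combination k1
      exact (mul_eq_zero.mp this).resolve_left (mul_ne_zero hc2 (pow_ne_zero _ (X_ne_zero _)))
    have l0 : C β * eraseVar 0 f = 0 := by
      have : (C (1 / ξ₁ ^ 2) * X 1 ^ 2) * (C β * eraseVar 0 f) = 0 := by linear_combination k0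
      exact (mul_eq_zero.mp this).resolve_left (mul_ne_zero hc1 (pow_ne_zero _ (X_ne_zero _)))
    refine (mul_eq_zero.mp (?_ : X 0 * X 1 * f = 0)).resolve_left hX
    linear_combination hf - C (1 / ξ₂ ^ 2) * X 0 ^ 2 * l1 - C (1 / ξ₁ ^ 2) * X 1 ^ 2 * l0
  have hH0 : H ≠ 0 := by
    rintro rfl
    exact one_ne_zero (@hinj 1 0 (by simp only [rightAct_op_zero]))
  exact ⟨⟨2, hH.hasOrder hH0, by rw [hH.top]; exact hinj⟩, hH.hasOrder hH0,
    coe_moduleW_eq_range h₁ h₂ hβ⟩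

/-! ### Sato operators and the Grassmannian -/

theorem coeff_rightAct_eq_zero {P : Op} {d : ℤ} (hd : d ∈ upperBounds (orderSet P.1)) {f : Poly}
    {n : ℕ} (hf : f.totalDegree ≤ n) {j : Expo} (hj : n + d < j.degree) :
    coeff j (rightAct f P) = 0 := by
  rw [coeff_rightAct_eq_finsum]
  refine Finset.sum_eq_zero fun p hp => ?_
  refine (finsum_congr fun i => ?_).trans finsum_zero
  by_contra h
  have h' := right_ne_zero_of_mul h
  have h1 : (p.1 + i).degree ≤ f.totalDegree :=
    le_totalDegree (mem_support_iff.mpr (left_ne_zero_of_mul h'))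
  have h2 := hd ⟨_, _, right_ne_zero_of_mul h', rfl⟩
  rw [mem_antidiagonal] at hp
  have h3 : (j.degree : ℤ) = p.1.degree + p.2.degree := by rw [← hp, map_add]; push_cast; rfl
  rw [map_add] at h1
  omega

/-- Reaching degree n + d forces equality in both bounds: only the top part of `f` and the symbol of
`P` contribute. -/
theorem coeff_rightAct_eq_coeff_component {P : Op} {d : ℤ} (hd : d ∈ upperBounds (orderSet P.1))
    {f : Poly} {n : ℕ} (hf : f.totalDegree ≤ n) {j : Expo} (hj : n + d = j.degree) :
    coeff j (rightAct f P) = coeff j (rightAct (homogeneousComponent n f) (component P (-d))) := by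
  simp only [coeff_rightAct_eq_finsum]
  refine Finset.sum_congr rfl fun p hp => finsum_congr fun i => ?_
  congr 1
  rw [coeff_component, coeff_homogeneousComponent]
  rw [mem_antidiagonal] at hp
  have h3 : (j.degree : ℤ) = p.1.degree + p.2.degree := by rw [← hp, map_add]; push_cast; rfl
  have hf' : coeff (p.1 + i) f ≠ 0 → p.1.degree + i.degree ≤ n := fun h => by
    rw [← map_add]
    exact (le_totalDegree (mem_support_iff.mpr h)).trans hf
  have hP : MvPowerSeries.coeff i (P.1 p.2) ≠ 0 → (p.2.degree : ℤ) - i.degree ≤ d :=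
    fun h => hd ⟨_, _, h, rfl⟩
  rw [map_add]
  by_cases h1 : coeff (p.1 + i) f = 0
  · simp [h1]
  by_cases h2 : MvPowerSeries.coeff i (P.1 p.2) = 0
  · simp [h2]
  have := hf' h1
  have := hP h2
  rw [if_pos (by omega), if_pos (by omega)]

theorem degree_eq_of_coeff_rightAct_component_ne_zero {P : Op} {d : ℤ} {f : Poly} {n : ℕ} {j : Expo}
    (h : coeff j (rightAct (homogeneousComponent n f) (component P (-d))) ≠ 0) :
    n + d = j.degree := by
  rw [coeff_rightAct_eq_finsum] at h
  obtain ⟨p, hp, h⟩ := Finset.exists_ne_zero_of_sum_ne_zero h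
  obtain ⟨i, h⟩ := exists_apply_ne_zero_of_finsum_ne_zero h
  have h' := right_ne_zero_of_mul h
  rw [coeff_component, coeff_homogeneousComponent, map_add] at h'
  rw [mem_antidiagonal] at hp
  have h3 : (j.degree : ℤ) = p.1.degree + p.2.degree := by rw [← hp, map_add]; push_cast; rfl
  split_ifs at h' with h1 h2
  · omega
  all_goals simp at h'

theorem card_degree_le (n : ℕ) : Nat.card {k : Expo | (k.sum fun _ e => e) ≤ n} =
    (n + 2).choose 2 := by
  have e : {k : Expo | (k.sum fun _ e => e) ≤ n} = ((Finset.range (n + 1)).sigma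
      fun m => antidiagonal m).image (fun x : (_ : ℕ) × (ℕ × ℕ) =>
        (Finsupp.single 0 x.2.1 + Finsupp.single 1 x.2.2 : Expo)) := by
    ext k
    have hk : (k.sum fun _ e => e) = k 0 + k 1 := by
      rw [Finsupp.sum_fintype _ _ (fun _ => rfl), Fin.sum_univ_two]
    simp only [Set.mem_ofPred_eq, hk, Finset.coe_image, Set.mem_image, Finset.mem_coe,
      Finset.mem_sigma, Finset.mem_range, mem_antidiagonal]
    constructor
    · intro h
      refine ⟨⟨k 0 + k 1, (k 0, k 1)⟩, ⟨by simpa [Nat.lt_succ_iff] using h, rfl⟩, ?_⟩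
      ext a; fin_cases a <;> simp
    · rintro ⟨⟨m, a, b⟩, ⟨h, h'⟩, rfl⟩
      simp only at h h' ⊢
      simp; omega
  rw [e, Nat.card_coe_set_eq, Set.ncard_coe_finset, Finset.card_image_of_injOn, Finset.card_sigma]
  · simp only [Finset.Nat.card_antidiagonal]
    rw [Finset.sum_range_succ', Nat.choose_two_right, ← Finset.sum_range_id_mul_two]
    simp [Finset.sum_range_succ' _ (n + 1), Finset.sum_range_succ' _ n]
  · rintro ⟨m, a, b⟩ h ⟨m', a', b'⟩ h' hab
    simp only [Finset.coe_sigma, Set.mem_sigma_iff, Finset.mem_coe, mem_antidiagonal] at h h'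
    have ha := DFunLike.congr_fun hab 0
    have hb := DFunLike.congr_fun hab 1
    simp at ha hb
    obtain ⟨-, rfl⟩ := h
    obtain ⟨-, rfl⟩ := h'
    subst ha hb
    rfl

theorem finrank_restrictTotalDegree (n : ℕ) :
    Module.finrank ℂ (restrictTotalDegree (Fin 2) ℂ n) = (n + 2).choose 2 := by
  rw [← card_degree_le n]
  exact Module.finrank_eq_nat_card_basis (basisRestrictSupport ℂ _)

/-- The symbol is injective, so it does not kill the leading form of `f`; hence degrees rise by
exactly μ. -/
theorem IsSatoOperator.exists_coeff_ne_zero {μ : ℕ} {W : Submodule ℂ Poly} {S : Op}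
    (h : IsSatoOperator μ W S) {f : Poly} (hf : f ≠ 0) :
    ∃ j : Expo, j.degree = μ + f.totalDegree ∧ coeff j (rightAct f S) ≠ 0 := by
  obtain ⟨d, hd, hinj⟩ := h.regular
  obtain rfl : d = μ := hd.unique h.order_eq
  have hne : homogeneousComponent f.totalDegree f ≠ 0 := by
    obtain ⟨m, hm, hm'⟩ := Finset.exists_mem_eq_sup f.support (support_nonempty.mpr hf)
      fun s => s.sum fun _ e => e
    intro h0
    have := congrArg (coeff m) h0
    rw [coeff_homogeneousComponent, if_pos, coeff_zero] at this
    · exact mem_support_iff.mp hm this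
    · exact hm'.symm
  have h0 : rightAct (homogeneousComponent f.totalDegree f) (component S (-(μ : ℤ))) ≠ 0 :=
    fun h0 => hne (hinj (h0.trans ((rightActₗ (component S (-(μ : ℤ)))).map_zero.symm)))
  obtain ⟨j, hj⟩ := MvPolynomial.exists_coeff_ne_zero h0
  have hdeg := degree_eq_of_coeff_rightAct_component_ne_zero hj
  refine ⟨j, by omega, ?_⟩
  rwa [coeff_rightAct_eq_coeff_component h.order_eq.1 le_rfl hdeg]

theorem IsSatoOperator.isInGr {μ : ℕ} {W : Submodule ℂ Poly} {S : Op}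
    (h : IsSatoOperator μ W S) : IsInGr μ W := by
  intro k
  have hinj : Function.Injective (rightActₗ S) := by
    rw [injective_iff_map_eq_zero]
    intro f hf
    by_contra hne
    obtain ⟨j, -, hj⟩ := h.exists_coeff_ne_zero hne
    rw [rightActₗ_apply] at hf
    rw [hf] at hj
    simp at hj
  -- The exact degree shift gives one inclusion, the order bound the other.
  have e : W ⊓ restrictTotalDegree (Fin 2) ℂ (μ + k) =
      (restrictTotalDegree (Fin 2) ℂ k).map (rightActₗ S) := by
    ext g
    rw [Submodule.mem_inf, Submodule.mem_map, mem_restrictTotalDegree]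
    constructor
    · rintro ⟨hg, hdeg⟩
      rw [← SetLike.mem_coe, h.range_eq] at hg
      obtain ⟨f, rfl⟩ := hg
      refine ⟨f, ?_, rfl⟩
      rw [mem_restrictTotalDegree]
      by_cases hf : f = 0
      · simp [hf]
      · obtain ⟨j, hj, hne⟩ := h.exists_coeff_ne_zero hf
        have : j.degree ≤ (rightAct f S).totalDegree := le_totalDegree (mem_support_iff.mpr hne)
        simp only at hdeg
        omega
    · rintro ⟨f, hf, rfl⟩
      rw [mem_restrictTotalDegree] at hf
      refine ⟨?_, ?_⟩
      · rw [← SetLike.mem_coe, h.range_eq]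
        exact ⟨f, rfl⟩
      · rw [totalDegree, Finset.sup_le_iff]
        intro j hj
        by_contra hlt
        refine mem_support_iff.mp hj (coeff_rightAct_eq_zero h.order_eq.1 hf ?_)
        have : μ + k < j.degree := not_le.mp hlt
        omega
  rw [e, ← (Submodule.equivMapOfInjective _ hinj _).finrank_eq, finrank_restrictTotalDegree]

/-! ### The algebra of quasi-invariants -/

theorem X_sq_mem_qAlg (i : Fin 2) : (X i ^ 2 : Poly) ∈ qAlg :=
  Algebra.subset_adjoin (by fin_cases i <;> simp)

theorem X_cube_mem_qAlg (i : Fin 2) : (X i ^ 3 : Poly) ∈ qAlg :=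
  Algebra.subset_adjoin (by fin_cases i <;> simp)

theorem C_mem_qAlg (c : ℂ) : (C c : Poly) ∈ qAlg := by
  rw [← algebraMap_eq]
  exact qAlg.algebraMap_mem c

theorem finiteType_qAlg : Algebra.FiniteType ℂ qAlg :=
  qAlg.fg_iff_finiteType.mp (Subalgebra.fg_def.mpr ⟨_, Set.toFinite _, rfl⟩)

theorem isNoetherianRing_qAlg : IsNoetherianRing qAlg :=
  have := finiteType_qAlg
  Algebra.FiniteType.isNoetherianRing ℂ qAlg

theorem isIntegral_qAlg : Algebra.IsIntegral qAlg Poly where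
  isIntegral f := by
    induction f using MvPolynomial.induction_on with
    | C a => exact isIntegral_algebraMap (A := Poly) (x := (⟨C a, C_mem_qAlg a⟩ : qAlg))
    | add p q hp hq => exact hp.add hq
    | mul_X p i hp =>
      refine hp.mul (IsIntegral.of_pow (n := 2) (by norm_num) ?_)
      exact isIntegral_algebraMap (A := Poly) (x := (⟨X i ^ 2, X_sq_mem_qAlg i⟩ : qAlg))

theorem finite_qAlg : Module.Finite qAlg Poly := by
  have := isIntegral_qAlg
  have : Algebra.FiniteType qAlg Poly := Algebra.FiniteType.of_restrictScalars_finiteType ℂ _ _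
  exact Algebra.IsIntegral.finite

theorem finite_moduleW (ξ₁ ξ₂ β : ℂ) : Module.Finite qAlg (moduleW ξ₁ ξ₂ β) := by
  have := finite_qAlg
  have := isNoetherianRing_qAlg
  infer_instance

/-- The element `zᵢ² - c²` of `A`. -/
def sqSub (i : Fin 2) (c : ℂ) : qAlg :=
  ⟨X i ^ 2 - C (c ^ 2), sub_mem (X_sq_mem_qAlg i) (C_mem_qAlg _)⟩

theorem coe_sqSub (i : Fin 2) (c : ℂ) : (sqSub i c : Poly) = X i ^ 2 - C (c ^ 2) := rfl

theorem X_sq_sub_C_ne_zero (i : Fin 2) (c : ℂ) : (X i ^ 2 - C c : Poly) ≠ 0 := by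
  intro h
  have := congrArg (fun f => pderiv i (pderiv i f)) h
  have h2 : pderiv i (2 : Poly) = 0 := pderiv_C (a := (2 : ℂ))
  simp [h2] at this

theorem sqSub_ne_zero (i : Fin 2) (c : ℂ) : sqSub i c ≠ 0 := fun h =>
  X_sq_sub_C_ne_zero i (c ^ 2) (congrArg Subtype.val h)

/-- The substitution `z₁ = c`. -/
def substZero (c : ℂ) : Poly →ₐ[ℂ] Poly := aeval ![C c, X 1]

theorem X_sub_C_dvd_sub_substZero (c : ℂ) (f : Poly) : X 0 - C c ∣ f - substZero c f := by
  induction f using MvPolynomial.induction_on with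
  | C a => simp [substZero, algebraMap_eq]
  | add p q hp hq =>
    rw [map_add, add_sub_add_comm]
    exact dvd_add hp hq
  | mul_X p i hp =>
    have : X 0 - C c ∣ X i - substZero c (X i) := by fin_cases i <;> simp [substZero]
    rw [map_mul, show p * X i - substZero c p * substZero c (X i) =
      (p - substZero c p) * X i + substZero c p * (X i - substZero c (X i)) by ring]
    exact dvd_add (hp.mul_right _) (this.mul_left _)

theorem X_sub_C_dvd_of_dvd_mul {b c : ℂ} {f : Poly} (h : X 0 - C c ∣ (X 1 ^ 2 - C b) * f) :
    X 0 - C c ∣ f := by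
  obtain ⟨g, hg⟩ := h
  have h0 := congrArg (substZero c) hg
  have e1 : substZero c (X 1 ^ 2 - C b) = X 1 ^ 2 - C b := by simp [substZero, algebraMap_eq]
  have e0 : substZero c (X 0 - C c) = 0 := by simp [substZero, algebraMap_eq]
  rw [map_mul, map_mul, e1, e0, zero_mul] at h0
  have h1 := (mul_eq_zero.mp h0).resolve_left (X_sq_sub_C_ne_zero 1 b)
  simpa [h1] using X_sub_C_dvd_sub_substZero c f

/-- The factors z₁ - c and z₁ + c are split off one after the other, which also covers the double
root c = 0. -/
theorem X_sq_sub_C_dvd_of_dvd_mul {b c : ℂ} {f : Poly}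
    (h : X 0 ^ 2 - C (c ^ 2) ∣ (X 1 ^ 2 - C b) * f) : X 0 ^ 2 - C (c ^ 2) ∣ f := by
  have e : (X 0 ^ 2 - C (c ^ 2) : Poly) = (X 0 - C c) * (X 0 - C (-c)) := by
    rw [C_pow, C_neg]; ring
  rw [e] at h ⊢
  have hne : (X 0 - C c : Poly) ≠ 0 := left_ne_zero_of_mul (e ▸ X_sq_sub_C_ne_zero 0 (c ^ 2))
  obtain ⟨g, rfl⟩ := X_sub_C_dvd_of_dvd_mul (dvd_of_mul_right_dvd h)
  rw [mul_left_comm, mul_dvd_mul_iff_left hne] at h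
  exact mul_dvd_mul_left _ (X_sub_C_dvd_of_dvd_mul h)

/-! ### The Cohen–Macaulay property -/

/-- On z₂ = 0 the factor z₁² - a² is nonzero with zero normal derivative, so it cancels from the
condition there. The factor z₂² - b² does the same on z₁ = 0. -/
theorem mem_moduleW_of_sqSub_mul_mem {ξ₁ ξ₂ β : ℂ} (h₁ : ξ₁ ≠ 0) (h₂ : ξ₂ ≠ 0) {a b : ℂ} {h : Poly}
    (h0 : (X 0 ^ 2 - C (a ^ 2)) * h ∈ moduleW ξ₁ ξ₂ β)
    (h1 : (X 1 ^ 2 - C (b ^ 2)) * h ∈ moduleW ξ₁ ξ₂ β) : h ∈ moduleW ξ₁ ξ₂ β := by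
  rw [mem_moduleW h₁ h₂] at h0 h1 ⊢
  replace h0 := h0.1
  replace h1 := h1.2
  simp only [pderiv_mul, map_sub, map_mul, map_pow, pderiv_pow, pderiv_C,
    pderiv_one_X_zero, pderiv_zero_X_one, eraseVar_C, eraseVar_one_X_zero, eraseVar_zero_X_one,
    mul_zero, sub_zero, zero_mul, zero_add] at h0 h1
  have n0 := X_sq_sub_C_ne_zero 0 (a ^ 2)
  have n1 := X_sq_sub_C_ne_zero 1 (b ^ 2)
  rw [C_pow] at n0 n1
  constructor
  · refine mul_left_cancel₀ n0 ?_
    rw [C_pow]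
    linear_combination h0
  · refine mul_left_cancel₀ n1 ?_
    rw [C_pow]
    linear_combination h1

theorem isWeaklyRegular_pair {B M : Type*} [CommRing B] [AddCommGroup M] [Module B M] {u v : B}
    (hu : IsSMulRegular M u) (hv : ∀ f g : M, u • g = v • f → ∃ h, u • h = f) :
    RingTheory.Sequence.IsWeaklyRegular M [u, v] := by
  rw [RingTheory.Sequence.isWeaklyRegular_cons_iff,
    RingTheory.Sequence.isWeaklyRegular_singleton_iff]
  refine ⟨hu, ?_⟩
  rw [isSMulRegular_quotient_iff_mem_of_smul_mem]
  intro f hf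
  rw [Submodule.mem_smul_pointwise_iff_exists] at hf ⊢
  obtain ⟨g, -, hg⟩ := hf
  obtain ⟨h, hh⟩ := hv f g hg
  exact ⟨h, trivial, hh⟩

/-- Weak regularity survives localization. An element with zero annihilator keeps each localized
module nonzero, and then finiteness and `rs` ⊆ 𝔪 give regularity by Nakayama. -/
theorem isMaximalCohenMacaulay_of_isWeaklyRegular {B M : Type*} [CommRing B] [AddCommGroup M]
    [Module B M] (hfin : Module.Finite B M) {m : M} (hm : ∀ b : B, b • m = 0 → b = 0)
    (h : ∀ (𝔪 : Ideal B) [𝔪.IsMaximal], ∃ rs : List B, RingTheory.Sequence.IsWeaklyRegular M rs ∧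
      (∀ r ∈ rs, r ∈ 𝔪) ∧ (rs.length : ℕ∞) = 𝔪.height) : IsMaximalCohenMacaulay B M := by
  refine ⟨hfin, fun 𝔪 _ => ?_⟩
  obtain ⟨rs, hrs, hmem, hlen⟩ := h 𝔪
  have hnt : Nontrivial (LocalizedModule 𝔪.primeCompl M) := by
    refine ⟨LocalizedModule.mkLinearMap 𝔪.primeCompl M m, 0, fun h => ?_⟩
    rw [IsLocalizedModule.eq_zero_iff 𝔪.primeCompl] at h
    obtain ⟨c, hc⟩ := h
    exact c.2 (hm c hc ▸ 𝔪.zero_mem)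
  have : Module.Finite (Localization.AtPrime 𝔪) (LocalizedModule 𝔪.primeCompl M) :=
    Module.Finite.of_isLocalizedModule 𝔪.primeCompl (LocalizedModule.mkLinearMap 𝔪.primeCompl M)
  refine ⟨rs.map (algebraMap B (Localization.AtPrime 𝔪)), ?_,
    hrs.isRegular_of_isLocalizedModule_of_mem
      (Localization.AtPrime 𝔪) 𝔪 (LocalizedModule.mkLinearMap 𝔪.primeCompl M) hmem, ?_⟩
  · intro r hr
    obtain ⟨s, hs, rfl⟩ := List.mem_map.mp hr
    rw [IsLocalization.AtPrime.to_map_mem_maximal_iff _ 𝔪]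
    exact hmem s hs
  · rw [IsLocalization.AtPrime.ringKrullDim_eq_height 𝔪, List.length_map, ← hlen]
    rfl

theorem isWeaklyRegular_moduleW {ξ₁ ξ₂ β : ℂ} (h₁ : ξ₁ ≠ 0) (h₂ : ξ₂ ≠ 0) (a b : ℂ) :
    RingTheory.Sequence.IsWeaklyRegular (moduleW ξ₁ ξ₂ β) [sqSub 0 a, sqSub 1 b] := by
  refine isWeaklyRegular_pair (fun x y hxy => ?_) fun f g hfg => ?_
  · have : (X 0 ^ 2 - C (a ^ 2)) * (x : Poly) = (X 0 ^ 2 - C (a ^ 2)) * (y : Poly) :=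
      congrArg Subtype.val hxy
    exact Subtype.ext (mul_left_cancel₀ (X_sq_sub_C_ne_zero 0 _) this)
  · replace hfg : (X 0 ^ 2 - C (a ^ 2)) * (g : Poly) = (X 1 ^ 2 - C (b ^ 2)) * (f : Poly) :=
      congrArg Subtype.val hfg
    obtain ⟨h, hh⟩ := X_sq_sub_C_dvd_of_dvd_mul (Dvd.intro _ hfg)
    have hg : (g : Poly) = (X 1 ^ 2 - C (b ^ 2)) * h := by
      refine mul_left_cancel₀ (X_sq_sub_C_ne_zero 0 (a ^ 2)) ?_
      rw [hfg, hh]; ring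
    exact ⟨⟨h, mem_moduleW_of_sqSub_mul_mem h₁ h₂ (hh ▸ f.2) (hg ▸ g.2)⟩, Subtype.ext hh.symm⟩

/-- Every maximal ideal of `A` consists of the elements of `A` that vanish at some point. -/
theorem exists_point_of_isMaximal (𝔪 : Ideal qAlg) [𝔪.IsMaximal] :
    ∃ x : Fin 2 → ℂ, ∀ f : qAlg, f ∈ 𝔪 ↔ aeval x (f : Poly) = 0 := by
  have := isIntegral_qAlg
  -- Lying over for A ⊆ R reduces the claim to the Nullstellensatz in R.
  obtain ⟨Q, hQ, hQ𝔪⟩ := Ideal.exists_ideal_over_maximal_of_isIntegral (S := Poly) 𝔪 (by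
    rw [(RingHom.injective_iff_ker_eq_bot _).mp (FaithfulSMul.algebraMap_injective qAlg Poly)]
    exact bot_le)
  obtain ⟨x, rfl⟩ := isMaximal_iff_eq_vanishingIdeal_singleton.mp hQ
  refine ⟨x, fun f => ?_⟩
  rw [← hQ𝔪, Ideal.mem_comap, mem_vanishingIdeal_singleton_iff]
  rfl

theorem sqSub_mem {𝔪 : Ideal qAlg} {x : Fin 2 → ℂ}
    (hx : ∀ f : qAlg, f ∈ 𝔪 ↔ aeval x (f : Poly) = 0) (i : Fin 2) : sqSub i (x i) ∈ 𝔪 := by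
  rw [hx, coe_sqSub]
  simp

/-- The chain is 0 < P < 𝔪, with P the functions in A vanishing on the line z₁ = `x 0`. -/
theorem two_le_height {𝔪 : Ideal qAlg} [𝔪.IsMaximal] {x : Fin 2 → ℂ}
    (hx : ∀ f : qAlg, f ∈ 𝔪 ↔ aeval x (f : Poly) = 0) : 2 ≤ 𝔪.height := by
  let P : Ideal qAlg := RingHom.ker ((substZero (x 0)).toRingHom.comp (algebraMap qAlg Poly))
  have hP (f : qAlg) : f ∈ P ↔ substZero (x 0) (f : Poly) = 0 := Iff.rfl
  have : P.IsPrime := RingHom.ker_isPrime _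
  have lt1 : (⊥ : Ideal qAlg) < P := by
    rw [bot_lt_iff_ne_bot]
    intro h
    have : sqSub 0 (x 0) ∈ P := by
      rw [hP, coe_sqSub]
      simp [substZero, algebraMap_eq]
    rw [h, Ideal.mem_bot] at this
    exact sqSub_ne_zero _ _ this
  have lt2 : P < 𝔪 := by
    refine lt_of_le_of_ne (fun f hf => ?_) fun h => ?_
    · rw [hx]
      have e : (aeval x : Poly →ₐ[ℂ] ℂ) = (aeval x).comp (substZero (x 0)) := by
        ext i
        fin_cases i <;> simp [substZero]
      rw [e, AlgHom.comp_apply, (hP f).mp hf, map_zero]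
    · have := sqSub_mem hx 1
      rw [← h, hP, coe_sqSub] at this
      refine X_sq_sub_C_ne_zero 1 (x 1 ^ 2) ?_
      simpa [substZero, algebraMap_eq] using this
  have k1 := Ideal.height_add_one_le_of_lt_of_isPrime lt1
  have k2 := Ideal.height_add_one_le_of_lt_of_isPrime lt2
  calc (2 : ℕ∞) = 0 + 1 + 1 := by norm_num
    _ ≤ (⊥ : Ideal qAlg).height + 1 + 1 := by gcongr; exact zero_le
    _ ≤ P.height + 1 := by gcongr
    _ ≤ 𝔪.height := k2

/-- Krull's height theorem applies, since 𝔪 is minimal over the two elements `sqSub`: a prime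
containing them lies under a prime of R containing some z₁ - c₁ and z₂ - c₂, so it is maximal. -/
theorem height_le_two {𝔪 : Ideal qAlg} [𝔪.IsMaximal] {x : Fin 2 → ℂ}
    (hx : ∀ f : qAlg, f ∈ 𝔪 ↔ aeval x (f : Poly) = 0) : 𝔪.height ≤ 2 := by
  classical
  have := isNoetherianRing_qAlg
  have hint := isIntegral_qAlg
  refine (Ideal.height_le_card_of_mem_minimalPrimes_span_finset
    (s := {sqSub 0 (x 0), sqSub 1 (x 1)}) ?_).trans (by exact_mod_cast Finset.card_le_two)
  refine ⟨⟨inferInstance, ?_⟩, fun p hp hle => ?_⟩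
  · rw [Ideal.span_le]
    intro f hf
    simp only [Finset.coe_insert, Finset.coe_singleton, Set.mem_insert_iff,
      Set.mem_singleton_iff] at hf
    rcases hf with rfl | rfl
    · exact sqSub_mem hx 0
    · exact sqSub_mem hx 1
  · obtain ⟨hpp, hps⟩ := hp
    obtain ⟨Q, -, hQ, hQp⟩ := Ideal.exists_ideal_over_prime_of_isIntegral p (⊥ : Ideal Poly) (by
      rw [← RingHom.ker_eq_comap_bot,
        (RingHom.injective_iff_ker_eq_bot _).mp (FaithfulSMul.algebraMap_injective qAlg Poly)]
      exact bot_le)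
    have key (i : Fin 2) : ∃ c : ℂ, X i - C c ∈ Q := by
      have hi : sqSub i (x i) ∈ p := by
        refine hps (Ideal.subset_span ?_)
        fin_cases i <;> simp
      rw [← hQp, Ideal.mem_comap] at hi
      change X i ^ 2 - C (x i ^ 2) ∈ Q at hi
      rw [show (X i ^ 2 - C (x i ^ 2) : Poly) = (X i - C (x i)) * (X i - C (-x i)) by
        rw [C_pow, C_neg]; ring] at hi
      rcases hQ.mem_or_mem hi with h | h
      exacts [⟨_, h⟩, ⟨_, h⟩]
    choose c hc using key
    have hcQ : vanishingIdeal ℂ {c} ≤ Q := by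
      intro f hf
      rw [mem_vanishingIdeal_singleton_iff] at hf
      have hsub : f - C (aeval c f) ∈ Q := by
        clear hf
        induction f using MvPolynomial.induction_on with
        | C a => simp
        | add p q hp hq =>
          rw [map_add, C_add, add_sub_add_comm]
          exact add_mem hp hq
        | mul_X p i hp =>
          rw [map_mul, aeval_X, C_mul, show p * X i - C (aeval c p) * C (c i) =
            X i * (p - C (aeval c p)) + C (aeval c p) * (X i - C (c i)) by ring]
          exact add_mem (Q.mul_mem_left _ hp) (Q.mul_mem_left _ (hc i))
      simpa [hf] using hsub
    have hmax : Q.IsMaximal := by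
      have h := isMaximal_iff_eq_vanishingIdeal_singleton.mpr ⟨c, rfl⟩
      rwa [← h.eq_of_le hQ.ne_top hcQ]
    have : p.IsMaximal := hQp ▸ Ideal.isMaximal_comap_of_isIntegral_of_isMaximal Q
    exact (this.eq_of_le (Ideal.IsMaximal.ne_top inferInstance) hle).ge

theorem genW_ne_zero (ξ₁ ξ₂ β : ℂ) : genW ξ₁ ξ₂ β ≠ 0 := by
  intro h
  have := congrArg constantCoeff h
  simp [genW] at this

theorem isMaximalCohenMacaulay_moduleW {ξ₁ ξ₂ β : ℂ} (h₁ : ξ₁ ≠ 0) (h₂ : ξ₂ ≠ 0)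
    (hβ : ξ₁ * ξ₂ - β ≠ 0) : IsMaximalCohenMacaulay qAlg (moduleW ξ₁ ξ₂ β) := by
  refine isMaximalCohenMacaulay_of_isWeaklyRegular (finite_moduleW ξ₁ ξ₂ β)
    (m := ⟨_, genW_mem h₁ h₂ hβ⟩) (fun c hc => ?_) fun 𝔪 _ => ?_
  · have hc' : (c : Poly) * genW ξ₁ ξ₂ β = 0 := congrArg Subtype.val hc
    exact Subtype.ext ((mul_eq_zero.mp hc').resolve_right (genW_ne_zero ξ₁ ξ₂ β))
  · obtain ⟨x, hx⟩ := exists_point_of_isMaximal 𝔪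
    refine ⟨[sqSub 0 (x 0), sqSub 1 (x 1)], isWeaklyRegular_moduleW h₁ h₂ _ _, fun r hr => ?_, ?_⟩
    · simp only [List.mem_cons, List.not_mem_nil, or_false] at hr
      rcases hr with rfl | rfl
      exacts [sqSub_mem hx 0, sqSub_mem hx 1]
    · rw [le_antisymm (height_le_two hx) (two_le_height hx)]
      rfl

/-! ### Projectivity -/

/-- A dual basis of a projective submodule of a domain `R` over a subring `B`, where `B` contains a
nonzero ideal of `R`. -/
theorem exists_dual_basis_of_projective {B R : Type*} [CommRing B] [CommRing R] [IsDomain R]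
    [Algebra B R] (hB : Function.Injective (algebraMap B R)) (N : Submodule B R) {c : R}
    (hc : c ≠ 0) (hcB : ∀ r, ∃ b : B, algebraMap B R b = c * r) (hN : Module.Projective B N)
    {r : R} (hr : r ∈ N) (hr0 : r ≠ 0) :
    ∃ (S : Finset N) (φ : N → N → B),
      (∀ x m : N, algebraMap B R (φ x m) * x = algebraMap B R (φ x x) * m) ∧
      ∑ x ∈ S, φ x x = 1 := by
  obtain ⟨s, hs⟩ := Module.projective_def.mp hN
  -- Since c x and c m lie in B, linearity can be applied to (c m) x = (c x) m.
  have comm (φ : N →ₗ[B] B) (x m : N) :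
      algebraMap B R (φ m) * x = algebraMap B R (φ x) * m := by
    obtain ⟨a, ha⟩ := hcB x
    obtain ⟨b, hb⟩ := hcB m
    have h1 : b • x = a • m := by
      apply Subtype.ext
      rw [Submodule.coe_smul, Submodule.coe_smul, Algebra.smul_def, Algebra.smul_def, ha, hb]
      ring
    have h2 := congrArg (algebraMap B R) (congrArg φ h1)
    rw [φ.map_smul, φ.map_smul, smul_eq_mul, smul_eq_mul, map_mul, map_mul, ha, hb] at h2
    refine mul_left_cancel₀ hc ?_
    linear_combination -h2
  refine ⟨(s ⟨r, hr⟩).support, fun x m => s m x, fun x m => comm (Finsupp.lapply x ∘ₗ s) x m, ?_⟩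
  apply hB
  refine mul_right_cancel₀ hr0 ?_
  have h := congrArg N.subtype (hs ⟨r, hr⟩)
  rw [Finsupp.linearCombination_apply, Finsupp.sum, map_sum] at h
  rw [map_one, one_mul, map_sum, Finset.sum_mul]
  refine Eq.trans (Finset.sum_congr rfl fun x _ => ?_) h
  rw [map_smul, Algebra.smul_def]
  exact (comm (Finsupp.lapply x ∘ₗ s) x ⟨r, hr⟩).symm

theorem X_pow_mem_qAlg (i : Fin 2) (n : ℕ) : (X i ^ (n + 2) : Poly) ∈ qAlg := by
  induction n using Nat.strong_induction_on with
  | _ n ih =>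
    match n with
    | 0 => exact X_sq_mem_qAlg i
    | 1 => exact X_cube_mem_qAlg i
    | n + 2 =>
      rw [pow_add]
      exact mul_mem (ih n (by omega)) (X_sq_mem_qAlg i)

theorem X_sq_mul_X_sq_mul_mem_qAlg (f : Poly) : X 0 ^ 2 * X 1 ^ 2 * f ∈ qAlg := by
  induction f using MvPolynomial.induction_on' with
  | add p q hp hq =>
    rw [mul_add]
    exact add_mem hp hq
  | monomial m c =>
    rw [monomial_eq_mul, show (X 0 ^ 2 * X 1 ^ 2 * (C c * (X 0 ^ m 0 * X 1 ^ m 1)) : Poly) =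
      C c * (X 0 ^ (m 0 + 2) * X 1 ^ (m 1 + 2)) by ring]
    exact mul_mem (C_mem_qAlg c) (mul_mem (X_pow_mem_qAlg 0 _) (X_pow_mem_qAlg 1 _))

theorem eraseVar_one_pderiv_eq_zero {f : Poly} (hf : f ∈ qAlg) : eraseVar 1 (pderiv 1 f) = 0 := by
  rw [← map_zero (eraseVar 1), ← line₁_eq_line₁_iff, map_zero]
  exact line₁_pderiv_eq_zero hf

theorem aeval_eraseVar_one (a : ℂ) (f : Poly) :
    aeval ![a, 0] (eraseVar 1 f) = aeval ![a, (0 : ℂ)] f := by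
  rw [← AlgHom.comp_apply]
  congr 1
  ext i
  fin_cases i <;> simp

theorem not_projective_moduleW {ξ₁ ξ₂ β : ℂ} (h₁ : ξ₁ ≠ 0) (h₂ : ξ₂ ≠ 0) (hβ : β ≠ 0) :
    ¬ Module.Projective qAlg (moduleW ξ₁ ξ₂ β) := by
  intro hproj
  have hm : (X 0 ^ 2 * X 1 ^ 2 : Poly) ∈ moduleW ξ₁ ξ₂ β := by
    rw [mem_moduleW h₁ h₂]
    simp
  have hm' : (C ξ₂ + C (ξ₂ ^ 2) * X 1 + C β * X 0) * X 0 ^ 2 ∈ moduleW ξ₁ ξ₂ β := by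
    rw [mem_moduleW h₁ h₂]
    simp
    ring
  have hX : (X 0 ^ 2 * X 1 ^ 2 : Poly) ≠ 0 :=
    mul_ne_zero (pow_ne_zero _ (X_ne_zero _)) (pow_ne_zero _ (X_ne_zero _))
  obtain ⟨S, φ, hφ, hsum⟩ := exists_dual_basis_of_projective Subtype.val_injective
    (moduleW ξ₁ ξ₂ β) hX (fun r => ⟨⟨_, X_sq_mul_X_sq_mul_mem_qAlg r⟩, rfl⟩) hproj hm hX
  -- The φ x x add up to 1, so one of them is nonzero at the common zero of W_β.
  obtain ⟨n, -, hn⟩ : ∃ n ∈ S, aeval ![-ξ₂ / β, (0 : ℂ)] (φ n n : Poly) ≠ 0 := by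
    by_contra! h
    have h' := congrArg (fun f : qAlg => aeval ![-ξ₂ / β, (0 : ℂ)] (f : Poly)) hsum
    simp only [AddSubmonoidClass.coe_finsetSum, map_sum, OneMemClass.coe_one, map_one] at h'
    rw [Finset.sum_eq_zero h] at h'
    exact zero_ne_one h'
  have k : (φ n ⟨_, hm⟩ : Poly) * (n : Poly) = (φ n n : Poly) * (X 0 ^ 2 * X 1 ^ 2) := hφ n ⟨_, hm⟩
  have k' : (φ n ⟨_, hm'⟩ : Poly) * (n : Poly) =
      (φ n n : Poly) * ((C ξ₂ + C (ξ₂ ^ 2) * X 1 + C β * X 0) * X 0 ^ 2) := hφ n ⟨_, hm'⟩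
  have hG := (φ n ⟨_, hm⟩).2
  obtain ⟨n, hnW⟩ := n
  replace hnW := ((mem_moduleW h₁ h₂ β n).mp hnW).1
  generalize (φ ⟨n, _⟩ ⟨n, _⟩ : Poly) = F at hn k k'
  generalize (φ ⟨n, _⟩ ⟨_, hm⟩ : Poly) = G at k hG
  generalize (φ ⟨n, _⟩ ⟨_, hm'⟩ : Poly) = K at k'
  -- The second test element `hm'` does not vanish identically on z₂ = 0. If `n` did, so would F,
  -- contrary to its value at the point.
  have hn0 : eraseVar 1 n ≠ 0 := by
    intro h0
    have := congrArg (eraseVar 1) k'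
    simp only [map_mul, map_add, map_pow, eraseVar_C, eraseVar_X_self, eraseVar_one_X_zero, h0,
      mul_zero, add_zero] at this
    have hF := (mul_eq_zero.mp this.symm).resolve_right
      (mul_ne_zero (linear_ne_zero h₂ β 0) (pow_ne_zero _ (X_ne_zero _)))
    rw [← aeval_eraseVar_one, hF, map_zero] at hn
    exact hn rfl
  have hG0 : eraseVar 1 G = 0 := by
    have := congrArg (eraseVar 1) k
    simp only [map_mul, map_pow, eraseVar_X_self, ne_eq, OfNat.ofNat_ne_zero, not_false_eq_true,
      zero_pow, mul_zero] at this
    exact (mul_eq_zero.mp this).resolve_right hn0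
  -- Membership of G in A kills its normal derivative, which upgrades divisibility by z₂ to
  -- divisibility by z₂².
  obtain ⟨s, rfl⟩ := X_sq_dvd hG0 (eraseVar_one_pderiv_eq_zero hG)
  have hs : s * n = F * X 0 ^ 2 := by
    refine mul_left_cancel₀ (pow_ne_zero 2 (X_ne_zero 1) : (X 1 ^ 2 : Poly) ≠ 0) ?_
    linear_combination k
  -- At this point ξ₂ + βz₁ = 0, so the line condition forces `n` to vanish.
  have hnq : aeval ![-ξ₂ / β, (0 : ℂ)] n = 0 := by
    have := congrArg (aeval ![-ξ₂ / β, (0 : ℂ)]) hnW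
    simp only [map_mul, map_add, aeval_eraseVar_one, aeval_C, aeval_X, Algebra.algebraMap_self,
      RingHom.id_apply, Matrix.cons_val_zero] at this
    rw [mul_div_cancel₀ _ hβ, add_neg_cancel, zero_mul] at this
    exact (mul_eq_zero.mp this.symm).resolve_left (pow_ne_zero _ h₂)
  have := congrArg (aeval ![-ξ₂ / β, (0 : ℂ)]) hs
  rw [map_mul, map_mul, hnq, mul_zero, map_pow, aeval_X, Matrix.cons_val_zero] at this
  exact mul_ne_zero hn (pow_ne_zero 2 (div_ne_zero (neg_ne_zero.mpr h₂) hβ)) this.symm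

end

end SatoExample

theorem theoremL (ξ₁ ξ₂ β : ℂ) (hξ : ξ₁ * ξ₂ ≠ 0) (hβ : β ≠ ξ₁ * ξ₂) :
    (SatoExample.moduleW ξ₁ ξ₂ β).restrictScalars ℂ = SatoExample.explicitW ξ₁ ξ₂ β ∧
    SatoExample.IsMaximalCohenMacaulay SatoExample.qAlg (SatoExample.moduleW ξ₁ ξ₂ β) ∧
    (β ≠ 0 → ¬ Module.Projective SatoExample.qAlg (SatoExample.moduleW ξ₁ ξ₂ β)) ∧
    SatoExample.IsInGr 2 ((SatoExample.moduleW ξ₁ ξ₂ β).restrictScalars ℂ) ∧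
    SatoExample.IsSatoOperator 2 ((SatoExample.moduleW ξ₁ ξ₂ β).restrictScalars ℂ)
      (SatoExample.opS ξ₁ ξ₂ β) := by
  have h₁ := left_ne_zero_of_mul hξ
  have h₂ := right_ne_zero_of_mul hξ
  have h₃ := sub_ne_zero.mpr hβ.symm
  have hS := SatoExample.isSatoOperator_opS h₁ h₂ h₃
  exact ⟨SatoExample.moduleW_eq_explicitW h₁ h₂ h₃,
    SatoExample.isMaximalCohenMacaulay_moduleW h₁ h₂ h₃,
    SatoExample.not_projective_moduleW h₁ h₂, hS.isInGr, hS⟩
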